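/- Let $\Bbbk$ be a field, let $(q_{ij})_{1\le i,j\le 2}$ be a matrix with entries in $\Bbbk^\times$, and let $V$ be the braided vector space of diagonal type with basis $x_1,x_2$ and braiding $c(x_i\otimes x_j)=q_{ij}\,x_j\otimes x_i$. Let $\mathcal B(V)=T(V)/\bigoplus_m\ker\mathfrak S_m$ be its Nichols algebra, where $\mathfrak S_m=\sum_{\sigma\in S_m}c_\sigma$ is the quantum symmetrizer on $V^{\otimes m}$, and let $\chi$ be the bicharacter on $\mathbb Z^2$ with $\chi(\alpha_i,\alpha_j)=q_{ij}$, where $\alpha_1,\alpha_2$ is the standard basis and $\deg x_i=\alpha_i$. Order words in $x_1<x_2$ lexicographically (a proper prefix of a word is smaller than the word). A nonempty word $w$ is a Lyndon word if $w<vu$ for every factorization $w=uv$ with $u,v$ nonempty. For a Lyndon word $u$ define $[u]\in\mathcal B(V)$ by $[x_i]=x_i$ and, for $|u|\ge 2$, $[u]=[v][w]-\chi(\deg v,\deg w)[w][v]$, where $u=vw$ is the factorization of $u$ into two Lyndon words with $|v|$ minimal; put $[u^k]=[u]^k$ for $k\ge1$. For $\alpha\in\mathbb Z^2$ let $o_\alpha\in\mathbb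 N\cup\{\infty\}$ be the multiplicative order of $\chi(\alpha,\alpha)$, and let $O_\alpha=\{1,o_\alpha,\infty\}$ if $o_\alpha=\infty$ or $\operatorname{char}\Bbbk=0$, and $O_\alpha=\{1,o_\alpha p^j,\infty\mid j\ge0\}$ if $o_\alpha<\infty$ and $p=\operatorname{char}\Bbbk>0$. For a word $w$, call $[w]$ a root vector candidate if $w=v^k$ for some Lyndon word $v$ and some $k\in O_{\deg v}\setminus\{\infty\}$. A root vector candidate $[w]$ is a root vector if it is not a $\Bbbk$-linear combination in $\mathcal B(V)$ of elements $[v_s]^{m_s}\cdots[v_1]^{m_1}$ with $s\ge 0$, $m_i\ge0$, and root vector candidates $[v_1],\dots,[v_s]$ such that $w<v_1<\dots<v_s$. Then the following hold. 1. Let $k\ge l\ge1$ be integers such that $[x_1^kx_2x_1^lx_2]$ is a root vector candidate but not a root vector. Then $[x_1^{k+1}x_2x_1^{l-1}x_2]$ is not a root vector. 2. Let $m\ge0$ and let $w<w'$ be words of degree $m\alpha_1+2\alpha_2$ such that $[w]$ and $[w']$ are root vector candidates. If $[w]$ is a root vector, then $[w']$ is a root vector. -/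

import Mathlib

namespace DiagNichols

/-! ## Words and Lyndon words

A word over the alphabet `x_0 < x_1 < ... < x_{n-1}` is a list of elements of `Fin n`, and words are
compared by the lexicographic order `<` on lists (a proper prefix of a word is smaller than it). -/

/-- A nonempty word `w` is a Lyndon word if `w < v u` for every decomposition `w = u v` into
nonempty words. -/
def IsLyndon {n : ℕ} (w : List (Fin n)) : Prop :=
  w ≠ [] ∧ ∀ u v : List (Fin n), u ≠ [] → v ≠ [] → w = u ++ v → w < v ++ u

/-- `w = (first i letters) (remaining letters)` is a decomposition into two Lyndon words. -/
def IsLyndonSplit {n : ℕ} (w : List (Fin n)) (i : ℕ) : Prop :=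
  IsLyndon (w.take i) ∧ IsLyndon (w.drop i)

/-- The word `w^k`. -/
def wordPow {n : ℕ} (w : List (Fin n)) (k : ℕ) : List (Fin n) := (List.replicate k w).flatten

/-- The degree in `ℤ^n` of a word. -/
def wordDeg {n : ℕ} (w : List (Fin n)) : Fin n → ℤ := fun i => (w.count i : ℤ)

theorem IsLyndonSplit.pos {n : ℕ} {w : List (Fin n)} {i : ℕ} (h : IsLyndonSplit w i) : 0 < i := by
  rcases Nat.eq_zero_or_pos i with rfl | hi
  · exact absurd (by simp) h.1.1
  · exact hi

theorem IsLyndonSplit.lt_length {n : ℕ} {w : List (Fin n)} {i : ℕ} (h : IsLyndonSplit w i) :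
    i < w.length := by
  by_contra hi
  exact h.2.1 (List.drop_eq_nil_of_le (not_lt.mp hi))

/-! ### Uniqueness of the Lyndon root of a power of a Lyndon word -/

theorem wordPow_succ {n : ℕ} (w : List (Fin n)) (k : ℕ) :
    wordPow w (k + 1) = w ++ wordPow w k := by
  simp [wordPow, List.replicate_succ]

theorem wordPow_succ' {n : ℕ} (w : List (Fin n)) (k : ℕ) :
    wordPow w (k + 1) = wordPow w k ++ w := by
  simp [wordPow, List.replicate_succ']

theorem length_wordPow {n : ℕ} (w : List (Fin n)) (k : ℕ) :
    (wordPow w k).length = k * w.length := by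
  simp [wordPow]

theorem not_lyndon_of_border {n : ℕ} {u s t : List (Fin n)} (hu : u ≠ []) (ht : t ≠ [])
    (h : u ++ t = s ++ u) : ¬ IsLyndon (u ++ t) := by
  intro hL
  have hlen : s.length = t.length := by
    have := congrArg List.length h
    simp at this
    omega
  have hs : s ≠ [] := by
    rintro rfl
    simp at hlen
    exact ht (List.length_eq_zero_iff.mp hlen.symm)
  have h1 : u ++ t < t ++ u := hL.2 u t hu ht rfl
  have h2 : u ++ t < u ++ s := hL.2 s u hs hu h
  have h3 : t < s := by
    clear h1 hL h hu
    induction u with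
    | nil => simpa using h2
    | cons a u ih =>
      apply ih
      simpa [List.cons_lt_cons_iff] using h2
  rw [h] at h1
  have h4 : ¬ (t < s) := by
    clear h2 h3 hL h hu ht hs
    induction s generalizing t with
    | nil =>
      cases t with
      | nil => simp
      | cons b t => simp at hlen
    | cons a s ih =>
      cases t with
      | nil => simp at hlen
      | cons b t =>
        simp only [List.cons_append, List.cons_lt_cons_iff] at h1 ⊢
        rintro (h5 | ⟨h5, h6⟩)
        · rcases h1 with h1 | ⟨h1, -⟩
          · exact lt_asymm h1 h5
          · exact absurd h5 (by simp [h1])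
        · rcases h1 with h1 | ⟨-, h1⟩
          · exact absurd h1 (by simp [h5])
          · exact ih (by simpa using hlen) h1 h6
  exact h4 h3

theorem lyndon_root_length_le {n : ℕ} {u v : List (Fin n)} {a b : ℕ} (hu : IsLyndon u)
    (hv : IsLyndon v) (ha : 0 < a) (hb : 0 < b) (h : wordPow u a = wordPow v b) :
    v.length ≤ u.length := by
  by_contra hlt
  push Not at hlt
  obtain ⟨a, rfl⟩ := Nat.exists_eq_add_of_lt ha
  obtain ⟨b, rfl⟩ := Nat.exists_eq_add_of_lt hb
  have hp : u <+: v := List.prefix_of_prefix_length_le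
    ⟨_, (wordPow_succ u _).symm⟩ (by rw [h]; exact ⟨_, (wordPow_succ v _).symm⟩) hlt.le
  have hs : u <:+ v := List.suffix_of_suffix_length_le
    ⟨_, (wordPow_succ' u _).symm⟩ (by rw [h]; exact ⟨_, (wordPow_succ' v _).symm⟩) hlt.le
  obtain ⟨t, rfl⟩ := hp
  obtain ⟨s, hs⟩ := hs
  have ht : t ≠ [] := by
    rintro rfl
    simp at hlt
  exact not_lyndon_of_border hu.1 ht hs.symm hv

theorem lyndon_root_unique {n : ℕ} {u v : List (Fin n)} {a b : ℕ} (hu : IsLyndon u)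
    (hv : IsLyndon v) (ha : 0 < a) (hb : 0 < b) (h : wordPow u a = wordPow v b) :
    u = v ∧ a = b := by
  have hlen : u.length = v.length :=
    le_antisymm (lyndon_root_length_le hv hu hb ha h.symm) (lyndon_root_length_le hu hv ha hb h)
  have hab : a = b := by
    have h1 := congrArg List.length h
    rw [length_wordPow, length_wordPow, hlen] at h1
    exact Nat.eq_of_mul_eq_mul_right (List.length_pos_iff.mpr hv.1) h1
  refine ⟨?_, hab⟩
  subst hab
  obtain ⟨a, rfl⟩ := Nat.exists_eq_add_of_lt ha
  rw [wordPow_succ, wordPow_succ] at h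
  exact (List.append_inj h hlen).1

/-! ## The Nichols algebra of a braided vector space of diagonal type

The braided vector space `V` has the basis `x_i`, `i : Fin n`, and the braiding
`c (x_i ⊗ x_j) = q i j • x_j ⊗ x_i`. Its tensor algebra is the free algebra on the `x_i`. -/

variable {𝕜 : Type*} [Field 𝕜] {n : ℕ}

/-- The bicharacter `χ` on `ℤ^n` with `χ(α_i, α_j) = q i j`. -/
def chi (q : Fin n → Fin n → 𝕜ˣ) (α β : Fin n → ℤ) : 𝕜ˣ :=
  ∏ i, ∏ j, q i j ^ (α i * β j)

/-- The monomial `x_{w_1} ⋯ x_{w_m}` in the tensor algebra. -/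
def monomial (𝕜 : Type*) [Field 𝕜] {n : ℕ} (w : List (Fin n)) : FreeAlgebra 𝕜 (Fin n) :=
  (w.map (FreeAlgebra.ι 𝕜)).prod

/-- The factor by which the braid lift of the permutation `σ` acts on the word `w`: each pair of
positions `i < j` that `σ` inverts contributes `q_{w_i w_j}`. -/
def braidCoeff (q : Fin n → Fin n → 𝕜ˣ) (w : List (Fin n)) (σ : Equiv.Perm (Fin w.length)) : 𝕜 :=
  ∏ p ∈ Finset.univ.filter
      (fun p : Fin w.length × Fin w.length => p.1 < p.2 ∧ σ p.2 < σ p.1),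
    (q (w.get p.1) (w.get p.2) : 𝕜)

/-- The quantum symmetrizer `⨁_m 𝔖_m` on `T(V) = ⨁_m V^{⊗ m}`, where `𝔖_m = ∑_{σ ∈ S_m} c_σ` and
`c_σ` is the action on `V^{⊗ m}` of the Matsumoto lift of `σ` to the braid group: it moves the
letter at position `i` to position `σ i`. -/
noncomputable def quantumSymmetrizer (q : Fin n → Fin n → 𝕜ˣ) :
    FreeAlgebra 𝕜 (Fin n) →ₗ[𝕜] FreeAlgebra 𝕜 (Fin n) :=
  (FreeAlgebra.basisFreeMonoid 𝕜 (Fin n)).constr 𝕜 fun w : FreeMonoid (Fin n) =>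
    ∑ σ : Equiv.Perm (Fin w.toList.length),
      braidCoeff q w.toList σ • monomial 𝕜 (List.ofFn fun i => w.toList.get (σ.symm i))

/-- The Nichols algebra `𝓑(V) = T(V) / ⨁_m ker 𝔖_m`. -/
abbrev NicholsAlgebra (q : Fin n → Fin n → 𝕜ˣ) : Type _ :=
  RingQuot fun a b : FreeAlgebra 𝕜 (Fin n) => quantumSymmetrizer q a = quantumSymmetrizer q b

/-- The canonical map `π : T(V) → 𝓑(V)`. -/
noncomputable def toNichols (q : Fin n → Fin n → 𝕜ˣ) :
    FreeAlgebra 𝕜 (Fin n) →ₐ[𝕜] NicholsAlgebra q :=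
  RingQuot.mkAlgHom 𝕜 _

/-! ## Super-letters, root vector candidates and root vectors -/

open Classical in
/-- The super-letter `[w] ∈ 𝓑(V)` of a Lyndon word `w`. If `w` has length at least two and `w = u v`
is its Shirshow decomposition (`u`, `v` Lyndon, `u` as short as possible), then
`[w] = [u][v] - χ(deg u, deg v) [v][u]`; if `w` is a letter `x_i`, then `[w] = x_i`.
(The value is not used for words that are not Lyndon.) -/
noncomputable def superLetter (q : Fin n → Fin n → 𝕜ˣ) (w : List (Fin n)) : NicholsAlgebra q :=
  if h : ∃ i, IsLyndonSplit w i then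
    superLetter q (w.take (Nat.find h)) * superLetter q (w.drop (Nat.find h)) -
      (chi q (wordDeg (w.take (Nat.find h))) (wordDeg (w.drop (Nat.find h))) : 𝕜) •
        (superLetter q (w.drop (Nat.find h)) * superLetter q (w.take (Nat.find h)))
  else toNichols q (monomial 𝕜 w)
termination_by w.length
decreasing_by
  all_goals
    have h1 := (Nat.find_spec h).pos
    have h2 := (Nat.find_spec h).lt_length
    simp only [List.length_take, List.length_drop]
    omega

open Classical in
/-- `[w] ∈ 𝓑(V)` for a power `w = v^k` (`k ≥ 1`) of a Lyndon word `v`: this is `[v]^k`.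
(`v` and `k` are determined by `w`; for other words the value `0` is not used.) -/
noncomputable def bracket (q : Fin n → Fin n → 𝕜ˣ) (w : List (Fin n)) : NicholsAlgebra q :=
  if h : ∃ p : List (Fin n) × ℕ, IsLyndon p.1 ∧ 0 < p.2 ∧ w = wordPow p.1 p.2 then
    superLetter q h.choose.1 ^ h.choose.2
  else 0

theorem bracket_wordPow (q : Fin n → Fin n → 𝕜ˣ) {v : List (Fin n)} (hv : IsLyndon v) {k : ℕ}
    (hk : 0 < k) : bracket q (wordPow v k) = superLetter q v ^ k := by
  have h : ∃ p : List (Fin n) × ℕ, IsLyndon p.1 ∧ 0 < p.2 ∧ wordPow v k = wordPow p.1 p.2 :=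
    ⟨(v, k), hv, hk, rfl⟩
  obtain ⟨h1, h2⟩ := lyndon_root_unique hv h.choose_spec.1 hk h.choose_spec.2.1 h.choose_spec.2.2
  rw [bracket, dif_pos h, ← h1, ← h2]

/-- The set `O_α \ {∞}`. With `o` the multiplicative order of `χ(α, α)`, it is `{1}` if `o = ∞`,
it is `{1, o}` if `o < ∞` and the characteristic is `0`, and it is
`{1} ∪ {o p^j | j ≥ 0}` if `o < ∞` and the characteristic is `p > 0`.
(`orderOf` is `0` for elements of infinite order.) -/
def heights (q : Fin n → Fin n → 𝕜ˣ) (α : Fin n → ℤ) : Set ℕ :=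
  {k | k = 1 ∨ (0 < orderOf (chi q α α) ∧
    ((ringChar 𝕜 = 0 ∧ k = orderOf (chi q α α)) ∨
      (0 < ringChar 𝕜 ∧ ∃ j : ℕ, k = orderOf (chi q α α) * ringChar 𝕜 ^ j)))}

/-- `[w]` is a root vector candidate: `w = v^k` with `v` a Lyndon word and
`k ∈ O_{deg v} \ {∞}`. -/
def IsRootVectorCandidate (q : Fin n → Fin n → 𝕜ˣ) (w : List (Fin n)) : Prop :=
  ∃ (v : List (Fin n)) (k : ℕ), IsLyndon v ∧ k ∈ heights q (wordDeg v) ∧ w = wordPow v k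

/-- The elements `[v_k]^{m_k} ⋯ [v_1]^{m_1}` of `𝓑(V)`, where the `[v_i]` are root vector candidates
and `w < v_1 < ⋯ < v_k`. The list `L` is `(v_k, m_k), …, (v_1, m_1)`. -/
def largerMonomials (q : Fin n → Fin n → 𝕜ˣ) (w : List (Fin n)) : Set (NicholsAlgebra q) :=
  {b | ∃ L : List (List (Fin n) × ℕ),
    (∀ p ∈ L, IsRootVectorCandidate q p.1 ∧ w < p.1) ∧
    L.Pairwise (fun p p' => p'.1 < p.1) ∧
    b = (L.map fun p => bracket q p.1 ^ p.2).prod}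

/-- `[w]` is a root vector of `𝓑(V)`: it is a root vector candidate and not a linear combination of
monomials in larger root vector candidates. -/
def IsRootVector (q : Fin n → Fin n → 𝕜ˣ) (w : List (Fin n)) : Prop :=
  IsRootVectorCandidate q w ∧ bracket q w ∉ Submodule.span 𝕜 (largerMonomials q w)

/-- The word `x_1^k x_2 x_1^l x_2` in the alphabet with two letters `x_1 < x_2`, which are
`0 < 1` in `Fin 2`. -/
def twoWord (k l : ℕ) : List (Fin 2) :=
  List.replicate k 0 ++ [1] ++ List.replicate l 0 ++ [1]

end DiagNichols

/-!
Write `u_a = [x_1^a x_2] = (ad x_1)^a (x_2)`. The root vector candidates of degree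
`m α_1 + 2 α_2` are the `[x_1^k x_2 x_1^l x_2]` with `k > l`, `k + l = m`, and possibly the square
of `u_k` if `m = 2 k` (then `χ(α, α) = -1` for `α = k α_1 + α_2`). By induction on `k - l`,
`[x_1^k x_2 x_1^l x_2]` is the braided commutator `u_k u_l - χ u_l u_k` up to products `u_i u_j`
with `i, j < k` (`superLetter_twoWord_sub_mem`). The monomials in larger candidates that have the
right degree span exactly the products `u_i u_j` with `i, j < k` and `i + j = m`; call this span
`W k m` (`pairSpan` in the code). So `[x_1^k x_2 x_1^l x_2]` fails to be a root vector if and only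
if the braided commutator of `u_k` and `u_l` lies in `W k m` (`not_isRootVector_twoWord_iff`).

Suppose that it does. The braided adjoint action of `x_1` maps `W k m` to `W (k + 1) (m + 1)`, and
it sends the commutator of `u_k` and `u_l` to that of `u_{k+1}` and `u_l` up to an element of
`W (k + 1) (m + 1)`. So the latter commutator is in `W (k + 1) (m + 1)`. The skew derivation `∂_1`
satisfies `∂_1 (u_a) = λ_a u_{a-1}` and maps `W (k + 1) (m + 1)` to `W (k + 1) m`; applied to the
commutator it yields `λ_l` times a unit times the commutator of `u_{k+1}` and `u_{l-1}`, modulo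
`W (k + 1) m`. If `λ_l ≠ 0`, this shows that `[x_1^{k+1} x_2 x_1^{l-1} x_2]` is not a root vector.
If `λ_l = 0`, then all skew derivations kill `u_l`, so that `u_l = 0` and hence `u_{k+1} = 0`, and
the commutator of `u_{k+1}` and `u_{l-1}` is zero (`pairComm_pred_mem`). The second assertion
follows from the first by iteration.

The facts about the Nichols algebra that this needs all come from one recursion,
`𝔖 (x_i a) = x_i * 𝔖 a` with the product `*` of the quantum shuffle algebra
(`quantumSymmetrizer_ι_mul`). Since left and right multiplications in the latter commute, the
kernel of `𝔖` is a two-sided ideal, so that the fibres of `T(V) → 𝓑(V)` are those of `𝔖`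
(`toNichols_eq_iff`). Moreover `𝔖` respects the grading and transforms `∂_i` into the removal of
a first letter `x_i`, so the grading and the skew derivations pass to `𝓑(V)`, and there an element
without constant term that all `∂_i` kill is zero (`toNichols_eq_zero_of_skewDeriv`).

In the code the letters `x_1`, `x_2` are `0`, `1` in `Fin 2`.
-/

namespace DiagNichols

variable {𝕜 : Type*} [Field 𝕜] {n : ℕ}

/-! ### Monomials in the tensor algebra -/

theorem monomial_nil : monomial 𝕜 ([] : List (Fin n)) = 1 := rfl

theorem monomial_cons (i : Fin n) (w : List (Fin n)) :
    monomial 𝕜 (i :: w) = FreeAlgebra.ι 𝕜 i * monomial 𝕜 w := by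
  simp [monomial]

theorem monomial_singleton (i : Fin n) : monomial 𝕜 [i] = FreeAlgebra.ι 𝕜 i := by
  simp [monomial]

theorem monomial_append (v w : List (Fin n)) :
    monomial 𝕜 (v ++ w) = monomial 𝕜 v * monomial 𝕜 w := by
  simp [monomial]

theorem basisFreeMonoid_apply (w : FreeMonoid (Fin n)) :
    FreeAlgebra.basisFreeMonoid 𝕜 (Fin n) w = monomial 𝕜 w.toList := by
  simp [FreeAlgebra.basisFreeMonoid, FreeAlgebra.equivMonoidAlgebraFreeMonoid, monomial,
    FreeMonoid.lift_apply]

/-- The linear map on the tensor algebra with prescribed values on monomials. -/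
noncomputable def onWords {M : Type*} [AddCommGroup M] [Module 𝕜 M] (f : List (Fin n) → M) :
    FreeAlgebra 𝕜 (Fin n) →ₗ[𝕜] M :=
  (FreeAlgebra.basisFreeMonoid 𝕜 (Fin n)).constr 𝕜 fun w => f w.toList

theorem onWords_monomial {M : Type*} [AddCommGroup M] [Module 𝕜 M] (f : List (Fin n) → M)
    (w : List (Fin n)) : onWords (𝕜 := 𝕜) f (monomial 𝕜 w) = f w := by
  have := (FreeAlgebra.basisFreeMonoid 𝕜 (Fin n)).constr_basis 𝕜 (fun w => f w.toList)
    (FreeMonoid.ofList w)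
  rwa [basisFreeMonoid_apply] at this

theorem monomial_induction {P : FreeAlgebra 𝕜 (Fin n) → Prop} (a : FreeAlgebra 𝕜 (Fin n))
    (h0 : P 0) (hadd : ∀ a b, P a → P b → P (a + b)) (hsmul : ∀ (c : 𝕜) a, P a → P (c • a))
    (hmon : ∀ w, P (monomial 𝕜 w)) : P a := by
  have ha := (FreeAlgebra.basisFreeMonoid 𝕜 (Fin n)).mem_span a
  induction ha using Submodule.span_induction with
  | mem x hx => obtain ⟨w, rfl⟩ := hx; rw [basisFreeMonoid_apply]; exact hmon _
  | zero => exact h0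
  | add x y _ _ hx hy => exact hadd _ _ hx hy
  | smul c x _ hx => exact hsmul _ _ hx

/-! ### The recursion for the quantum symmetrizer -/

/-- The quantum shuffle product of the letter `x_i` with a word: the sum over all positions at which
`x_i` can be inserted, where passing a letter `x_a` from its left to its right costs `q i a`. -/
def insertLeftWord (q : Fin n → Fin n → 𝕜ˣ) (i : Fin n) : List (Fin n) → FreeAlgebra 𝕜 (Fin n)
  | [] => monomial 𝕜 [i]
  | a :: w => monomial 𝕜 (i :: a :: w) +
      (q i a : 𝕜) • (FreeAlgebra.ι 𝕜 a * insertLeftWord q i w)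

/-- Left multiplication by `x_i` in the quantum shuffle algebra. -/
noncomputable def insertLeft (q : Fin n → Fin n → 𝕜ˣ) (i : Fin n) :
    FreeAlgebra 𝕜 (Fin n) →ₗ[𝕜] FreeAlgebra 𝕜 (Fin n) :=
  onWords (insertLeftWord q i)

theorem insertLeft_one (q : Fin n → Fin n → 𝕜ˣ) (i : Fin n) :
    insertLeft q i 1 = FreeAlgebra.ι 𝕜 i := by
  rw [← monomial_nil, insertLeft, onWords_monomial, insertLeftWord, monomial_singleton]

theorem insertLeft_ι_mul (q : Fin n → Fin n → 𝕜ˣ) (i j : Fin n) (a : FreeAlgebra 𝕜 (Fin n)) :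
    insertLeft q i (FreeAlgebra.ι 𝕜 j * a) = FreeAlgebra.ι 𝕜 i * (FreeAlgebra.ι 𝕜 j * a) +
      (q i j : 𝕜) • (FreeAlgebra.ι 𝕜 j * insertLeft q i a) := by
  induction a using monomial_induction with
  | h0 => simp
  | hadd a b ha hb => simp only [mul_add, map_add, ha, hb, smul_add]; abel
  | hsmul c a ha => simp only [mul_smul_comm, map_smul, ha, smul_add, smul_comm c]
  | hmon w =>
    rw [← monomial_cons, insertLeft, onWords_monomial, insertLeftWord, onWords_monomial,
      monomial_cons i]

/-- The insertion of `x_i` at position `j` is a term whose coefficient collects the letters that end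
up before `x_i`. -/
theorem insertLeft_ofFn (q : Fin n → Fin n → 𝕜ˣ) (i : Fin n) {m : ℕ} (g : Fin m → Fin n) :
    insertLeft q i (monomial 𝕜 (List.ofFn g)) =
      ∑ j : Fin (m + 1), (∏ y : Fin m, if y.castSucc < j then (q i (g y) : 𝕜) else 1) •
        monomial 𝕜 (List.ofFn (j.insertNth i g : Fin (m + 1) → Fin n)) := by
  induction m with
  | zero => simp [monomial_nil, insertLeft_one, monomial_singleton]
  | succ m ih =>
    rw [List.ofFn_succ, monomial_cons, insertLeft_ι_mul, ih (fun y => g y.succ)]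
    refine Eq.trans ?_ (Fin.sum_univ_succ _).symm
    congr 1
    · simp [Fin.insertNth_zero', List.ofFn_succ, monomial_cons]
    · rw [Finset.mul_sum, Finset.smul_sum]
      refine Finset.sum_congr rfl fun j _ => ?_
      have h1 : (j.succ.insertNth i g : Fin (m + 2) → Fin n) =
          Fin.cons (g 0) (j.insertNth i (fun y => g y.succ) : Fin (m + 1) → Fin n) := by
        conv_lhs => rw [← Fin.cons_self_tail g]
        rw [Fin.insertNth_succ_cons]
        rfl
      rw [h1, List.ofFn_succ, monomial_cons, Fin.prod_univ_succ, mul_smul, mul_smul_comm]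
      simp [monomial_cons]

/-- The permutation `σ` of `{0, …, m}` with `σ 0 = j` that permutes the other points as `τ` does,
for a pair `(j, τ)`: `σ (x + 1)` is `τ x` after the points other than `j` have been numbered in order. -/
def insertZeroPerm {m : ℕ} (p : Fin (m + 1) × Equiv.Perm (Fin m)) : Equiv.Perm (Fin (m + 1)) :=
  ((finSuccEquiv' 0).trans (Equiv.optionCongr p.2)).trans (finSuccEquiv' p.1).symm

theorem insertZeroPerm_zero {m : ℕ} (p : Fin (m + 1) × Equiv.Perm (Fin m)) :
    insertZeroPerm p 0 = p.1 := by
  simp [insertZeroPerm]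

theorem insertZeroPerm_succ {m : ℕ} (p : Fin (m + 1) × Equiv.Perm (Fin m)) (x : Fin m) :
    insertZeroPerm p x.succ = p.1.succAbove (p.2 x) := by
  have := finSuccEquiv'_succAbove (0 : Fin (m + 1)) x
  rw [Fin.succAbove_zero] at this
  simp [insertZeroPerm, this]

theorem insertZeroPerm_bijective (m : ℕ) : Function.Bijective (insertZeroPerm (m := m)) := by
  rw [Fintype.bijective_iff_injective_and_card]
  constructor
  · rintro ⟨j, τ⟩ ⟨j', τ'⟩ h
    have h0 : j = j' := by
      simpa [insertZeroPerm_zero] using congrArg (fun σ => σ 0) h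
    subst h0
    congr 1
    ext x
    have := congrArg (fun σ => σ x.succ) h
    simp only [insertZeroPerm_succ] at this
    rw [Fin.succAbove_right_injective this]
  · simp [Fintype.card_perm, Nat.factorial_succ]

theorem quantumSymmetrizer_monomial (q : Fin n → Fin n → 𝕜ˣ) (w : List (Fin n)) :
    quantumSymmetrizer q (monomial 𝕜 w) = ∑ σ : Equiv.Perm (Fin w.length),
      braidCoeff q w σ • monomial 𝕜 (List.ofFn fun i => w.get (σ.symm i)) := by
  have := basisFreeMonoid_apply (𝕜 := 𝕜) (FreeMonoid.ofList w)
  rw [FreeMonoid.toList_ofList] at this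
  rw [quantumSymmetrizer, ← this]
  exact (FreeAlgebra.basisFreeMonoid 𝕜 (Fin n)).constr_basis 𝕜 _ (FreeMonoid.ofList w)

/-- The inversions of the permutation given by `(j, τ)` are those of `τ`, together with the
inversions that involve the first position. The latter pair the first letter with the `j` letters that end up
before it. -/
theorem braidCoeff_cons (q : Fin n → Fin n → 𝕜ˣ) (i : Fin n) (w : List (Fin n))
    (j : Fin (w.length + 1)) (τ : Equiv.Perm (Fin w.length)) :
    braidCoeff q (i :: w) (insertZeroPerm (j, τ)) =
      braidCoeff q w τ *
        ∏ y : Fin w.length, if y.castSucc < j then (q i (w.get (τ.symm y)) : 𝕜) else 1 := by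
  rw [braidCoeff, braidCoeff, Finset.prod_filter, Finset.prod_filter, Fintype.prod_prod_type,
    Fintype.prod_prod_type]
  refine (Fin.prod_univ_succ (n := w.length) _).trans ?_
  rw [mul_comm]
  congr 1
  · refine Finset.prod_congr rfl fun x _ => ?_
    refine (Fin.prod_univ_succ (n := w.length) _).trans ?_
    have h0 : ¬ (x.succ < (0 : Fin (w.length + 1))) := by simp
    rw [if_neg (fun h => h0 h.1), one_mul]
    refine Finset.prod_congr rfl fun y _ => ?_
    have h1 := insertZeroPerm_succ (j, τ) x
    have h2 := insertZeroPerm_succ (j, τ) y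
    have h3 : (x.succ < y.succ ∧
        insertZeroPerm (j, τ) y.succ < insertZeroPerm (j, τ) x.succ) ↔ (x < y ∧ τ y < τ x) := by
      rw [h1, h2]; simp
    exact if_congr h3 rfl rfl
  · refine (Fin.prod_univ_succ (n := w.length) _).trans ?_
    rw [if_neg (fun h => lt_irrefl _ h.1), one_mul]
    refine Eq.trans ?_ (Equiv.prod_comp τ _)
    refine Finset.prod_congr rfl fun y _ => ?_
    have h1 := insertZeroPerm_zero (j, τ)
    have h2 := insertZeroPerm_succ (j, τ) y
    have h3 : ((0 : Fin (w.length + 1)) < y.succ ∧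
        insertZeroPerm (j, τ) y.succ < insertZeroPerm (j, τ) 0) ↔ ((τ y).castSucc < j) := by
      rw [h1, h2]; simp [Fin.succAbove_lt_iff_castSucc_lt]
    rw [Equiv.symm_apply_apply]
    exact if_congr h3 rfl rfl

theorem ofFn_get_insertZeroPerm (i : Fin n) (w : List (Fin n))
    (j : Fin (w.length + 1)) (τ : Equiv.Perm (Fin w.length)) :
    (fun y : Fin (w.length + 1) => (i :: w).get ((insertZeroPerm (j, τ)).symm y)) =
      (j.insertNth i (fun y => w.get (τ.symm y)) : Fin (w.length + 1) → Fin n) := by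
  rw [Fin.eq_insertNth_iff]
  constructor
  · have : (insertZeroPerm (j, τ)).symm j = 0 := by
      rw [Equiv.symm_apply_eq, insertZeroPerm_zero]
    simp [this]
  · funext y
    have : (insertZeroPerm (j, τ)).symm (j.succAbove y) = (τ.symm y).succ := by
      rw [Equiv.symm_apply_eq, insertZeroPerm_succ, Equiv.apply_symm_apply]
    simp [this, Fin.removeNth]

theorem quantumSymmetrizer_one (q : Fin n → Fin n → 𝕜ˣ) : quantumSymmetrizer q 1 = 1 := by
  rw [← monomial_nil, quantumSymmetrizer_monomial]
  simp [braidCoeff]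

/-- The quantum symmetrizer turns left multiplication by `x_i` into left multiplication in the
quantum shuffle algebra. The permutations are sorted by the image of the first position. -/
theorem quantumSymmetrizer_ι_mul (q : Fin n → Fin n → 𝕜ˣ) (i : Fin n)
    (a : FreeAlgebra 𝕜 (Fin n)) :
    quantumSymmetrizer q (FreeAlgebra.ι 𝕜 i * a) = insertLeft q i (quantumSymmetrizer q a) := by
  induction a using monomial_induction with
  | h0 => simp
  | hadd a b ha hb => simp only [mul_add, map_add, ha, hb]
  | hsmul c a ha => simp only [mul_smul_comm, map_smul, ha]
  | hmon w =>
    rw [← monomial_cons, quantumSymmetrizer_monomial, quantumSymmetrizer_monomial, map_sum]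
    simp_rw [map_smul, insertLeft_ofFn, Finset.smul_sum, smul_smul]
    refine ((insertZeroPerm_bijective w.length).sum_comp _).symm.trans ?_
    rw [Fintype.sum_prod_type, Finset.sum_comm]
    refine Finset.sum_congr rfl fun τ _ => Finset.sum_congr rfl fun j _ => ?_
    rw [← braidCoeff_cons, ← ofFn_get_insertZeroPerm]
    rfl

/-! ### The kernel of the quantum symmetrizer is an ideal -/

/-- The automorphism of the tensor algebra that multiplies a word `w` by `χ(deg w, α_i)`. -/
noncomputable def twist (q : Fin n → Fin n → 𝕜ˣ) (i : Fin n) :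
    FreeAlgebra 𝕜 (Fin n) →ₐ[𝕜] FreeAlgebra 𝕜 (Fin n) :=
  FreeAlgebra.lift 𝕜 fun j => (q j i : 𝕜) • FreeAlgebra.ι 𝕜 j

theorem twist_ι (q : Fin n → Fin n → 𝕜ˣ) (i j : Fin n) :
    twist q i (FreeAlgebra.ι 𝕜 j) = (q j i : 𝕜) • FreeAlgebra.ι 𝕜 j := by
  simp [twist]

/-- The quantum shuffle product of a word with the letter `x_i` on its right: the sum over all
positions at which `x_i` can be inserted, where passing a letter `x_a` from its right to its left
costs `q a i`. -/
noncomputable def insertRightWord (q : Fin n → Fin n → 𝕜ˣ) (i : Fin n) :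
    List (Fin n) → FreeAlgebra 𝕜 (Fin n)
  | [] => FreeAlgebra.ι 𝕜 i
  | a :: w => FreeAlgebra.ι 𝕜 a * insertRightWord q i w +
      FreeAlgebra.ι 𝕜 i * twist q i (monomial 𝕜 (a :: w))

/-- Right multiplication by `x_i` in the quantum shuffle algebra. -/
noncomputable def insertRight (q : Fin n → Fin n → 𝕜ˣ) (i : Fin n) :
    FreeAlgebra 𝕜 (Fin n) →ₗ[𝕜] FreeAlgebra 𝕜 (Fin n) :=
  onWords (insertRightWord q i)

theorem insertRight_one (q : Fin n → Fin n → 𝕜ˣ) (i : Fin n) :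
    insertRight q i 1 = FreeAlgebra.ι 𝕜 i := by
  rw [← monomial_nil, insertRight, onWords_monomial, insertRightWord]

theorem insertRight_ι_mul (q : Fin n → Fin n → 𝕜ˣ) (i j : Fin n) (a : FreeAlgebra 𝕜 (Fin n)) :
    insertRight q i (FreeAlgebra.ι 𝕜 j * a) = FreeAlgebra.ι 𝕜 j * insertRight q i a +
      FreeAlgebra.ι 𝕜 i * twist q i (FreeAlgebra.ι 𝕜 j * a) := by
  induction a using monomial_induction with
  | h0 => simp
  | hadd a b ha hb => simp only [mul_add, map_add, ha, hb]; abel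
  | hsmul c a ha => simp only [mul_smul_comm, map_smul, ha, smul_add]
  | hmon w =>
    rw [← monomial_cons, insertRight, onWords_monomial, insertRightWord, onWords_monomial]

theorem twist_insertLeft (q : Fin n → Fin n → 𝕜ˣ) (i j : Fin n) (a : FreeAlgebra 𝕜 (Fin n)) :
    twist q i (insertLeft q j a) = (q j i : 𝕜) • insertLeft q j (twist q i a) := by
  induction a using monomial_induction with
  | h0 => simp
  | hadd a b ha hb => simp only [map_add, ha, hb, smul_add]
  | hsmul c a ha => simp only [map_smul, ha, smul_comm c]
  | hmon w =>
    induction w with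
    | nil => simp [monomial_nil, insertLeft_one, twist_ι]
    | cons b w ih =>
      simp only [monomial_cons, insertLeft_ι_mul, map_add, map_smul, map_mul, twist_ι, ih,
        smul_mul_assoc, mul_smul_comm, smul_add, smul_smul]
      congr 2 <;> ring

/-- Left and right multiplication in the quantum shuffle algebra commute. This yields the recursion
of the quantum symmetrizer for right multiplication from the one for left multiplication. -/
theorem insertLeft_insertRight (q : Fin n → Fin n → 𝕜ˣ) (i j : Fin n)
    (a : FreeAlgebra 𝕜 (Fin n)) :
    insertRight q i (insertLeft q j a) = insertLeft q j (insertRight q i a) := by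
  induction a using monomial_induction with
  | h0 => simp
  | hadd a b ha hb => simp only [map_add, ha, hb]
  | hsmul c a ha => simp only [map_smul, ha]
  | hmon w =>
    induction w with
    | nil =>
      rw [monomial_nil, insertLeft_one, insertRight_one,
        ← mul_one (FreeAlgebra.ι 𝕜 j), insertRight_ι_mul, ← mul_one (FreeAlgebra.ι 𝕜 i),
        insertLeft_ι_mul, insertLeft_one, insertRight_one]
      simp [twist_ι]
    | cons b w ih =>
      simp only [monomial_cons, insertLeft_ι_mul, insertRight_ι_mul, map_add, map_smul, map_mul,
        twist_ι, ih, twist_insertLeft, smul_mul_assoc, mul_smul_comm, smul_add, smul_smul,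
        mul_add, add_assoc]
      simp only [mul_comm, mul_left_comm]
      abel

theorem quantumSymmetrizer_mul_ι (q : Fin n → Fin n → 𝕜ˣ) (i : Fin n)
    (a : FreeAlgebra 𝕜 (Fin n)) :
    quantumSymmetrizer q (a * FreeAlgebra.ι 𝕜 i) = insertRight q i (quantumSymmetrizer q a) := by
  induction a using monomial_induction with
  | h0 => simp
  | hadd a b ha hb => simp only [add_mul, map_add, ha, hb]
  | hsmul c a ha => simp only [smul_mul_assoc, map_smul, ha]
  | hmon w =>
    induction w with
    | nil =>
      rw [monomial_nil, one_mul, quantumSymmetrizer_one, insertRight_one,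
        ← mul_one (FreeAlgebra.ι 𝕜 i), quantumSymmetrizer_ι_mul, quantumSymmetrizer_one,
        insertLeft_one, mul_one]
    | cons b w ih =>
      rw [monomial_cons, mul_assoc, quantumSymmetrizer_ι_mul, ih, quantumSymmetrizer_ι_mul,
        insertLeft_insertRight]

theorem quantumSymmetrizer_mul_eq_zero_left (q : Fin n → Fin n → 𝕜ˣ)
    {a : FreeAlgebra 𝕜 (Fin n)} (ha : quantumSymmetrizer q a = 0) (b : FreeAlgebra 𝕜 (Fin n)) :
    quantumSymmetrizer q (b * a) = 0 := by
  induction b using monomial_induction with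
  | h0 => simp
  | hadd b c hb hc => simp [add_mul, hb, hc]
  | hsmul c b hb => simp [hb]
  | hmon w =>
    induction w with
    | nil => simpa [monomial_nil]
    | cons i w ih => rw [monomial_cons, mul_assoc, quantumSymmetrizer_ι_mul, ih, map_zero]

theorem quantumSymmetrizer_mul_eq_zero_right (q : Fin n → Fin n → 𝕜ˣ)
    {a : FreeAlgebra 𝕜 (Fin n)} (ha : quantumSymmetrizer q a = 0) (b : FreeAlgebra 𝕜 (Fin n)) :
    quantumSymmetrizer q (a * b) = 0 := by
  induction b using monomial_induction with
  | h0 => simp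
  | hadd b c hb hc => simp [mul_add, hb, hc]
  | hsmul c b hb => simp [hb]
  | hmon w =>
    induction w using List.reverseRecOn with
    | nil => simpa [monomial_nil]
    | append_singleton w i ih =>
      rw [monomial_append, monomial_singleton, ← mul_assoc, quantumSymmetrizer_mul_ι, ih, map_zero]

/-- The congruence on the tensor algebra whose classes are the fibres of the quantum symmetrizer. -/
def symmetrizerCon (q : Fin n → Fin n → 𝕜ˣ) : RingCon (FreeAlgebra 𝕜 (Fin n)) where
  r a b := quantumSymmetrizer q a = quantumSymmetrizer q b
  iseqv := ⟨fun _ => rfl, fun h => h.symm, fun h h' => h.trans h'⟩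
  mul' {a b c d} h h' := by
    have h1 : quantumSymmetrizer q ((a - b) * c) = 0 :=
      quantumSymmetrizer_mul_eq_zero_right q (by rw [map_sub, h, sub_self]) c
    have h2 : quantumSymmetrizer q (b * (c - d)) = 0 :=
      quantumSymmetrizer_mul_eq_zero_left q (by rw [map_sub, h', sub_self]) b
    rw [← sub_eq_zero, ← map_sub]
    rw [show a * c - b * d = (a - b) * c + b * (c - d) by noncomm_ring, map_add, h1, h2, add_zero]
  add' {a b c d} h h' := by
    simp only [map_add, h, h']

/-- The fibres of `T(V) → 𝓑(V)` are those of the quantum symmetrizer, since the kernel of the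
latter is already a two-sided ideal. -/
theorem toNichols_eq_iff (q : Fin n → Fin n → 𝕜ˣ) {a b : FreeAlgebra 𝕜 (Fin n)} :
    toNichols q a = toNichols q b ↔ quantumSymmetrizer q a = quantumSymmetrizer q b := by
  refine ⟨fun h => ?_, fun h => RingQuot.mkAlgHom_rel 𝕜 h⟩
  have hr : ∀ ⦃x y : FreeAlgebra 𝕜 (Fin n)⦄, quantumSymmetrizer q x = quantumSymmetrizer q y →
      (symmetrizerCon q).mk' x = (symmetrizerCon q).mk' y := fun x y hxy =>
    (RingCon.eq _).mpr hxy
  let F := RingQuot.lift ⟨(symmetrizerCon q).mk', hr⟩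
  have h1 : ∀ x, F (toNichols q x) = (symmetrizerCon q).mk' x := fun x => by
    have e : toNichols q x = RingQuot.mkRingHom _ x :=
      RingHom.congr_fun (RingQuot.mkAlgHom_coe 𝕜 _) x
    rw [e]
    exact RingQuot.lift_mkRingHom_apply _ _ _
  have h2 : (symmetrizerCon q).mk' a = (symmetrizerCon q).mk' b := by rw [← h1, ← h1, h]
  exact (RingCon.eq _).mp h2

theorem toNichols_eq_zero_iff (q : Fin n → Fin n → 𝕜ˣ) {a : FreeAlgebra 𝕜 (Fin n)} :
    toNichols q a = 0 ↔ quantumSymmetrizer q a = 0 := by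
  rw [← map_zero (toNichols q), toNichols_eq_iff, map_zero]

/-! ### Skew derivations -/

/-- The value of the skew derivation `∂_i` on a word: the sum over the occurrences of `x_i`, each of
which is moved to the front, at the cost `q a i` for each letter `x_a` passed, and removed there. -/
noncomputable def skewDerivWord (q : Fin n → Fin n → 𝕜ˣ) (i : Fin n) :
    List (Fin n) → FreeAlgebra 𝕜 (Fin n)
  | [] => 0
  | a :: w => (if a = i then monomial 𝕜 w else 0) +
      (q a i : 𝕜) • (FreeAlgebra.ι 𝕜 a * skewDerivWord q i w)

/-- The skew derivation of the tensor algebra given by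
`∂_i(v w) = ∂_i(v) w + χ(deg v, α_i) v ∂_i(w)` and `∂_i(x_j) = δ_{ij}`. -/
noncomputable def skewDeriv (q : Fin n → Fin n → 𝕜ˣ) (i : Fin n) :
    FreeAlgebra 𝕜 (Fin n) →ₗ[𝕜] FreeAlgebra 𝕜 (Fin n) :=
  onWords (skewDerivWord q i)

theorem skewDeriv_one (q : Fin n → Fin n → 𝕜ˣ) (i : Fin n) : skewDeriv q i 1 = 0 := by
  rw [← monomial_nil, skewDeriv, onWords_monomial, skewDerivWord]

theorem skewDeriv_ι_mul (q : Fin n → Fin n → 𝕜ˣ) (i j : Fin n) (a : FreeAlgebra 𝕜 (Fin n)) :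
    skewDeriv q i (FreeAlgebra.ι 𝕜 j * a) = (if j = i then a else 0) +
      (q j i : 𝕜) • (FreeAlgebra.ι 𝕜 j * skewDeriv q i a) := by
  induction a using monomial_induction with
  | h0 => simp
  | hadd a b ha hb => simp only [mul_add, map_add, ha, hb, smul_add]; split_ifs <;> abel
  | hsmul c a ha =>
    simp only [mul_smul_comm, map_smul, ha, smul_add, smul_comm c]; split_ifs <;> simp
  | hmon w =>
    rw [← monomial_cons, skewDeriv, onWords_monomial, skewDerivWord, onWords_monomial]

theorem skewDeriv_mul (q : Fin n → Fin n → 𝕜ˣ) (i : Fin n) (a b : FreeAlgebra 𝕜 (Fin n)) :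
    skewDeriv q i (a * b) = skewDeriv q i a * b + twist q i a * skewDeriv q i b := by
  induction a using monomial_induction with
  | h0 => simp
  | hadd a c ha hc => simp only [add_mul, map_add, ha, hc]; abel
  | hsmul c a ha => simp only [smul_mul_assoc, map_smul, ha, smul_add]
  | hmon w =>
    induction w with
    | nil => simp [monomial_nil, skewDeriv_one]
    | cons j w ih =>
      rw [monomial_cons, mul_assoc, skewDeriv_ι_mul, ih, skewDeriv_ι_mul, map_mul, twist_ι]
      simp only [add_mul, mul_add, smul_add, smul_mul_assoc, mul_assoc, ite_mul, zero_mul,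
        add_assoc]

/-- The word without its first letter if this letter is `x_i`, and `0` otherwise. -/
def cutWord (𝕜 : Type*) [Field 𝕜] (i : Fin n) : List (Fin n) → FreeAlgebra 𝕜 (Fin n)
  | [] => 0
  | a :: w => if a = i then monomial 𝕜 w else 0

/-- The linear map that removes the first letter of a word if this letter is `x_i`, and sends the
other words to `0`. -/
noncomputable def cut (𝕜 : Type*) [Field 𝕜] (i : Fin n) :
    FreeAlgebra 𝕜 (Fin n) →ₗ[𝕜] FreeAlgebra 𝕜 (Fin n) :=
  onWords (cutWord 𝕜 i)

theorem cut_one (i : Fin n) : cut 𝕜 i 1 = 0 := by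
  rw [← monomial_nil, cut, onWords_monomial, cutWord]

theorem cut_ι_mul (i j : Fin n) (a : FreeAlgebra 𝕜 (Fin n)) :
    cut 𝕜 i (FreeAlgebra.ι 𝕜 j * a) = if j = i then a else 0 := by
  induction a using monomial_induction with
  | h0 => simp
  | hadd a b ha hb => simp only [mul_add, map_add, ha, hb]; split_ifs <;> simp
  | hsmul c a ha => simp only [mul_smul_comm, map_smul, ha]; split_ifs <;> simp
  | hmon w => rw [← monomial_cons, cut, onWords_monomial, cutWord]

theorem cut_insertLeft (q : Fin n → Fin n → 𝕜ˣ) (i j : Fin n) (a : FreeAlgebra 𝕜 (Fin n)) :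
    cut 𝕜 i (insertLeft q j a) =
      (if j = i then a else 0) + (q j i : 𝕜) • insertLeft q j (cut 𝕜 i a) := by
  induction a using monomial_induction with
  | h0 => simp
  | hadd a b ha hb => simp only [map_add, ha, hb, smul_add]; split_ifs <;> abel
  | hsmul c a ha =>
    simp only [map_smul, ha, smul_add, smul_comm c]; split_ifs <;> simp
  | hmon w =>
    cases w with
    | nil =>
      rw [monomial_nil, insertLeft_one, ← mul_one (FreeAlgebra.ι 𝕜 j), cut_ι_mul, cut_one]
      simp
    | cons b w =>
      rw [monomial_cons, insertLeft_ι_mul, map_add, map_smul, cut_ι_mul, cut_ι_mul, cut_ι_mul]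
      by_cases hb : b = i
      · subst hb; simp
      · simp [hb]

/-- On the side of the quantum shuffle algebra, the skew derivation `∂_i` just removes a first
letter `x_i`. -/
theorem quantumSymmetrizer_skewDeriv (q : Fin n → Fin n → 𝕜ˣ) (i : Fin n)
    (a : FreeAlgebra 𝕜 (Fin n)) :
    quantumSymmetrizer q (skewDeriv q i a) = cut 𝕜 i (quantumSymmetrizer q a) := by
  induction a using monomial_induction with
  | h0 => simp
  | hadd a b ha hb => simp only [map_add, ha, hb]
  | hsmul c a ha => simp only [map_smul, ha]
  | hmon w =>
    induction w with
    | nil => rw [monomial_nil, skewDeriv_one, quantumSymmetrizer_one, cut_one, map_zero]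
    | cons j w ih =>
      rw [monomial_cons, skewDeriv_ι_mul, quantumSymmetrizer_ι_mul, cut_insertLeft, map_add,
        map_smul, quantumSymmetrizer_ι_mul, ih]
      split_ifs <;> simp

theorem toNichols_skewDeriv_eq_zero (q : Fin n → Fin n → 𝕜ˣ) (i : Fin n)
    {a : FreeAlgebra 𝕜 (Fin n)} (h : toNichols q a = 0) : toNichols q (skewDeriv q i a) = 0 := by
  rw [toNichols_eq_zero_iff] at h ⊢
  rw [quantumSymmetrizer_skewDeriv, h, map_zero]

theorem constCoeff_add_sum_cut (a : FreeAlgebra 𝕜 (Fin n)) :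
    a = algebraMap 𝕜 _ (FreeAlgebra.algebraMapInv a) +
      ∑ i, FreeAlgebra.ι 𝕜 i * cut 𝕜 i a := by
  induction a using monomial_induction with
  | h0 => simp
  | hadd a b ha hb =>
    conv_lhs => rw [ha, hb]
    simp only [map_add, mul_add, Finset.sum_add_distrib]; abel
  | hsmul c a ha =>
    rw [map_smul, smul_eq_mul, map_mul, ← Algebra.smul_def]
    simp_rw [map_smul, mul_smul_comm]
    rw [← Finset.smul_sum, ← smul_add, ← ha]
  | hmon w =>
    cases w with
    | nil => simp [monomial_nil, cut_one]
    | cons b w => simp [monomial_cons, cut_ι_mul, FreeAlgebra.algebraMapInv]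

theorem algebraMapInv_quantumSymmetrizer (q : Fin n → Fin n → 𝕜ˣ) (a : FreeAlgebra 𝕜 (Fin n)) :
    FreeAlgebra.algebraMapInv (quantumSymmetrizer q a) = FreeAlgebra.algebraMapInv a := by
  have hL : ∀ i b, FreeAlgebra.algebraMapInv (insertLeft q i b) = 0 := fun i b => by
    induction b using monomial_induction with
    | h0 => simp
    | hadd a b ha hb => simp only [map_add, ha, hb, add_zero]
    | hsmul c a ha => simp only [map_smul, ha, smul_zero]
    | hmon w =>
      cases w with
      | nil => simp [monomial_nil, insertLeft_one, FreeAlgebra.algebraMapInv]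
      | cons j w => simp [monomial_cons, insertLeft_ι_mul, FreeAlgebra.algebraMapInv]
  induction a using monomial_induction with
  | h0 => simp
  | hadd a b ha hb => simp only [map_add, ha, hb]
  | hsmul c a ha => simp only [map_smul, ha]
  | hmon w =>
    cases w with
    | nil => rw [monomial_nil, quantumSymmetrizer_one]
    | cons j w =>
      rw [monomial_cons, quantumSymmetrizer_ι_mul, hL]
      simp [FreeAlgebra.algebraMapInv]

/-- The defining property of a Nichols algebra: an element without constant term that all skew
derivations annihilate is zero. -/
theorem toNichols_eq_zero_of_skewDeriv (q : Fin n → Fin n → 𝕜ˣ) {a : FreeAlgebra 𝕜 (Fin n)}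
    (h0 : FreeAlgebra.algebraMapInv a = (0 : 𝕜))
    (h : ∀ i, toNichols q (skewDeriv q i a) = 0) : toNichols q a = 0 := by
  rw [toNichols_eq_zero_iff, constCoeff_add_sum_cut (quantumSymmetrizer q a),
    algebraMapInv_quantumSymmetrizer, h0, map_zero, zero_add]
  refine Finset.sum_eq_zero fun i _ => ?_
  rw [← quantumSymmetrizer_skewDeriv, (toNichols_eq_zero_iff q).mp (h i), mul_zero]

/-! ### The grading -/

theorem wordDeg_append (v w : List (Fin n)) : wordDeg (v ++ w) = wordDeg v + wordDeg w := by
  funext i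
  simp [wordDeg]

/-- The homogeneous component of degree `d` of the tensor algebra. -/
def homogeneous (𝕜 : Type*) [Field 𝕜] (d : Fin n → ℤ) : Submodule 𝕜 (FreeAlgebra 𝕜 (Fin n)) :=
  Submodule.span 𝕜 {a | ∃ w, wordDeg w = d ∧ a = monomial 𝕜 w}

theorem monomial_mem_homogeneous (w : List (Fin n)) :
    monomial 𝕜 w ∈ homogeneous 𝕜 (wordDeg w) :=
  Submodule.subset_span ⟨w, rfl, rfl⟩

theorem mul_mem_homogeneous {d e : Fin n → ℤ} {a b : FreeAlgebra 𝕜 (Fin n)}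
    (ha : a ∈ homogeneous 𝕜 d) (hb : b ∈ homogeneous 𝕜 e) : a * b ∈ homogeneous 𝕜 (d + e) := by
  have h := Submodule.mul_mem_mul ha hb
  rw [homogeneous, homogeneous, Submodule.span_mul_span] at h
  refine Submodule.span_mono ?_ h
  rintro _ ⟨_, ⟨v, rfl, rfl⟩, _, ⟨w, rfl, rfl⟩, rfl⟩
  exact ⟨v ++ w, wordDeg_append v w, (monomial_append v w).symm⟩

open Classical in
/-- The projection of the tensor algebra onto its homogeneous component of degree `d`. -/
noncomputable def degProj (𝕜 : Type*) [Field 𝕜] (d : Fin n → ℤ) :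
    FreeAlgebra 𝕜 (Fin n) →ₗ[𝕜] FreeAlgebra 𝕜 (Fin n) :=
  onWords fun w => if wordDeg w = d then monomial 𝕜 w else 0

open Classical in
theorem degProj_of_mem {d e : Fin n → ℤ} {a : FreeAlgebra 𝕜 (Fin n)} (ha : a ∈ homogeneous 𝕜 e) :
    degProj 𝕜 d a = if e = d then a else 0 := by
  induction ha using Submodule.span_induction with
  | mem x hx =>
    obtain ⟨w, rfl, rfl⟩ := hx
    rw [degProj, onWords_monomial]
  | zero => simp
  | add x y _ _ hx hy => rw [map_add, hx, hy]; split_ifs <;> simp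
  | smul c x _ hx => rw [map_smul, hx]; split_ifs <;> simp

theorem quantumSymmetrizer_monomial_mem (q : Fin n → Fin n → 𝕜ˣ) (w : List (Fin n)) :
    quantumSymmetrizer q (monomial 𝕜 w) ∈ homogeneous 𝕜 (wordDeg w) := by
  rw [quantumSymmetrizer_monomial]
  refine Submodule.sum_mem _ fun σ _ => Submodule.smul_mem _ _ (Submodule.subset_span ⟨_, ?_, rfl⟩)
  have h := Equiv.Perm.ofFn_comp_perm σ.symm w.get
  rw [List.ofFn_get] at h
  funext i
  exact congrArg Nat.cast (h.count_eq i)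

theorem quantumSymmetrizer_degProj (q : Fin n → Fin n → 𝕜ˣ) (d : Fin n → ℤ)
    (a : FreeAlgebra 𝕜 (Fin n)) :
    quantumSymmetrizer q (degProj 𝕜 d a) = degProj 𝕜 d (quantumSymmetrizer q a) := by
  classical
  induction a using monomial_induction with
  | h0 => simp
  | hadd a b ha hb => simp only [map_add, ha, hb]
  | hsmul c a ha => simp only [map_smul, ha]
  | hmon w =>
    rw [degProj_of_mem (monomial_mem_homogeneous w),
      degProj_of_mem (quantumSymmetrizer_monomial_mem q w)]
    split_ifs <;> simp

/-- The Nichols algebra is graded: if an element of degree `d` is a linear combination of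
homogeneous elements, then it is already a combination of those of degree `d`. -/
theorem mem_of_mem_span_homogeneous (q : Fin n → Fin n → 𝕜ˣ) {X : Set (NicholsAlgebra q)}
    {W : Submodule 𝕜 (NicholsAlgebra q)} {d : Fin n → ℤ}
    (hX : ∀ y ∈ X, ∃ e, ∃ a ∈ homogeneous 𝕜 e, toNichols q a = y ∧ (e = d → y ∈ W))
    {x : NicholsAlgebra q} (hx : x ∈ Submodule.span 𝕜 X)
    (hd : ∃ a ∈ homogeneous 𝕜 d, toNichols q a = x) : x ∈ W := by
  classical
  have key : ∃ a, toNichols q a = x ∧ toNichols q (degProj 𝕜 d a) ∈ W := by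
    clear hd
    induction hx using Submodule.span_induction with
    | mem y hy =>
      obtain ⟨e, a, ha, rfl, hW⟩ := hX y hy
      refine ⟨a, rfl, ?_⟩
      rw [degProj_of_mem ha]
      split_ifs with h
      · exact hW h
      · simp
    | zero => exact ⟨0, by simp, by simp⟩
    | add y z _ _ hy hz =>
      obtain ⟨a, rfl, ha⟩ := hy
      obtain ⟨b, rfl, hb⟩ := hz
      exact ⟨a + b, map_add _ _ _, by simpa only [map_add] using W.add_mem ha hb⟩
    | smul c y _ hy =>
      obtain ⟨a, rfl, ha⟩ := hy
      exact ⟨c • a, map_smul _ _ _, by simpa only [map_smul] using W.smul_mem c ha⟩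
  obtain ⟨a, ha, hW⟩ := key
  obtain ⟨b, hb, hbx⟩ := hd
  have h1 : toNichols q (degProj 𝕜 d a) = toNichols q (degProj 𝕜 d b) := by
    rw [toNichols_eq_iff, quantumSymmetrizer_degProj, quantumSymmetrizer_degProj,
      (toNichols_eq_iff q).mp (ha.trans hbx.symm)]
  rwa [h1, degProj_of_mem hb, if_pos rfl, hbx] at hW

theorem superLetter_homogeneous (q : Fin n → Fin n → 𝕜ˣ) (w : List (Fin n)) :
    ∃ a ∈ homogeneous 𝕜 (wordDeg w), toNichols q a = superLetter q w := by
  classical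
  induction hm : w.length using Nat.strong_induction_on generalizing w with
  | _ m ih =>
    subst hm
    rw [superLetter]
    split_ifs with h
    · have h1 := (Nat.find_spec h).pos
      have h2 := (Nat.find_spec h).lt_length
      obtain ⟨a, ha, hae⟩ := ih _ (by simp only [List.length_take]; omega)
        (w.take (Nat.find h)) rfl
      obtain ⟨b, hb, hbe⟩ := ih _ (by simp only [List.length_drop]; omega)
        (w.drop (Nat.find h)) rfl
      have hw : wordDeg w = wordDeg (w.take (Nat.find h)) + wordDeg (w.drop (Nat.find h)) := by
        rw [← wordDeg_append, List.take_append_drop]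
      rw [← hae, ← hbe]
      refine ⟨a * b - (chi q (wordDeg (w.take (Nat.find h))) (wordDeg (w.drop (Nat.find h))) : 𝕜) •
        (b * a), ?_, ?_⟩
      · rw [hw]
        refine Submodule.sub_mem _ (mul_mem_homogeneous ha hb) (Submodule.smul_mem _ _ ?_)
        rw [add_comm]
        exact mul_mem_homogeneous hb ha
      · simp only [map_sub, map_mul, map_smul]
    · exact ⟨_, monomial_mem_homogeneous w, rfl⟩

theorem prod_superLetter_homogeneous (q : Fin n → Fin n → 𝕜ˣ) (N : List (List (Fin n))) :
    ∃ a ∈ homogeneous 𝕜 (wordDeg N.flatten),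
      toNichols q a = (N.map (superLetter q)).prod := by
  induction N with
  | nil => exact ⟨1, monomial_mem_homogeneous (𝕜 := 𝕜) ([] : List (Fin n)), by simp⟩
  | cons v N ih =>
    obtain ⟨a, ha, hae⟩ := ih
    obtain ⟨b, hb, hbe⟩ := superLetter_homogeneous q v
    refine ⟨b * a, ?_, by simp [hae, hbe]⟩
    rw [List.flatten_cons, wordDeg_append]
    exact mul_mem_homogeneous hb ha

/-! ### Lyndon words with at most two letters `x_2` -/

/-- The super-letter of a Lyndon word from its Shirshow decomposition. -/
theorem superLetter_append (q : Fin n → Fin n → 𝕜ˣ) {u v : List (Fin n)} (hu : IsLyndon u)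
    (hv : IsLyndon v) (hmin : ∀ i < u.length, ¬ IsLyndonSplit (u ++ v) i) :
    superLetter q (u ++ v) = superLetter q u * superLetter q v -
      (chi q (wordDeg u) (wordDeg v) : 𝕜) • (superLetter q v * superLetter q u) := by
  classical
  have hs : IsLyndonSplit (u ++ v) u.length := by
    rw [IsLyndonSplit, List.take_left, List.drop_left]
    exact ⟨hu, hv⟩
  have h : ∃ i, IsLyndonSplit (u ++ v) i := ⟨_, hs⟩
  have hf : Nat.find h = u.length := (Nat.find_eq_iff h).mpr ⟨hs, hmin⟩
  rw [superLetter, dif_pos h, hf, List.take_left, List.drop_left]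

theorem superLetter_singleton (q : Fin n → Fin n → 𝕜ˣ) (i : Fin n) :
    superLetter q [i] = toNichols q (FreeAlgebra.ι 𝕜 i) := by
  classical
  rw [superLetter, dif_neg, monomial_singleton]
  rintro ⟨j, hj⟩
  have h1 := hj.pos
  have h2 := hj.lt_length
  simp at h2
  omega

theorem isLyndon_singleton (i : Fin n) : IsLyndon [i] := by
  refine ⟨by simp, fun u v hu hv h => ?_⟩
  have h1 := congrArg List.length h
  have h2 := List.length_pos_iff.mpr hu
  have h3 := List.length_pos_iff.mpr hv
  simp at h1
  omega

/-- The word `x_1^a x_2`. -/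
def oneWord (a : ℕ) : List (Fin 2) := List.replicate a 0 ++ [1]

theorem oneWord_zero : oneWord 0 = [1] := rfl

theorem oneWord_succ (a : ℕ) : oneWord (a + 1) = 0 :: oneWord a := rfl

theorem oneWord_add (a b : ℕ) : oneWord (a + b) = List.replicate a 0 ++ oneWord b := by
  simp [oneWord, ← List.append_assoc]

theorem oneWord_ne_nil (a : ℕ) : oneWord a ≠ [] := by simp [oneWord]

theorem twoWord_eq (a b : ℕ) : twoWord a b = oneWord a ++ oneWord b := by
  simp [twoWord, oneWord]

theorem count_oneWord (a : ℕ) : (oneWord a).count 1 = 1 := by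
  simp [oneWord, List.count_replicate]

theorem wordDeg_oneWord (a : ℕ) : wordDeg (oneWord a) = ![(a : ℤ), 1] := by
  funext i
  fin_cases i <;> simp [wordDeg, oneWord, List.count_replicate]

theorem wordDeg_twoWord (a b : ℕ) : wordDeg (twoWord a b) = ![((a + b : ℕ) : ℤ), 2] := by
  rw [twoWord_eq, wordDeg_append, wordDeg_oneWord, wordDeg_oneWord]
  funext i
  fin_cases i <;> simp

theorem oneWord_append_inj {a b : ℕ} {x y : List (Fin 2)} (h : oneWord a ++ x = oneWord b ++ y) :
    a = b ∧ x = y := by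
  induction a generalizing b with
  | zero => cases b <;> simp_all [oneWord_zero, oneWord_succ]
  | succ a ih =>
    cases b with
    | zero => simp [oneWord_zero, oneWord_succ] at h
    | succ b =>
      simp only [oneWord_succ, List.cons_append, List.cons.injEq, true_and] at h
      obtain ⟨rfl, rfl⟩ := ih h
      exact ⟨rfl, rfl⟩

theorem oneWord_append_lt_iff {a b : ℕ} {x y : List (Fin 2)} :
    oneWord a ++ x < oneWord b ++ y ↔ b < a ∨ (a = b ∧ x < y) := by
  induction a generalizing b with
  | zero => cases b <;> simp [oneWord_zero, oneWord_succ, List.cons_lt_cons_iff]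
  | succ a ih =>
    cases b with
    | zero => simp [oneWord_zero, oneWord_succ, List.cons_lt_cons_iff]
    | succ b => simp [oneWord_succ, ih]

theorem not_oneWord_append_lt_replicate (a c : ℕ) (x : List (Fin 2)) :
    ¬ oneWord a ++ x < List.replicate c 0 := by
  induction a generalizing c with
  | zero => cases c <;> simp [oneWord_zero, List.replicate_succ, List.cons_lt_cons_iff]
  | succ a ih =>
    cases c <;> simp [oneWord_succ, List.replicate_succ, ih]

theorem eq_replicate_of_count_eq_zero {w : List (Fin 2)} (h : w.count 1 = 0) :
    w = List.replicate w.length 0 := by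
  rw [List.eq_replicate_iff]
  refine ⟨rfl, fun b hb => ?_⟩
  have := List.count_eq_zero.mp h
  fin_cases b
  · rfl
  · exact absurd hb this

theorem exists_eq_oneWord_append {w : List (Fin 2)} (h : 0 < w.count 1) :
    ∃ a x, w = oneWord a ++ x := by
  induction w with
  | nil => simp at h
  | cons b w ih =>
    fin_cases b
    · obtain ⟨a, x, rfl⟩ := ih (by simpa using h)
      exact ⟨a + 1, x, rfl⟩
    · exact ⟨0, w, rfl⟩

theorem IsLyndon.eq_oneWord {w : List (Fin 2)} (hw : IsLyndon w) (h : w.count 1 = 1) :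
    ∃ a, w = oneWord a := by
  obtain ⟨a, x, rfl⟩ := exists_eq_oneWord_append (by omega : 0 < w.count 1)
  rw [List.count_append, count_oneWord] at h
  have hx := eq_replicate_of_count_eq_zero (by omega : x.count 1 = 0)
  by_cases hx0 : x = []
  · exact ⟨a, by simp [hx0]⟩
  have h1 := hw.2 _ _ (oneWord_ne_nil a) hx0 rfl
  rw [hx, ← oneWord_add, ← List.append_nil (oneWord (x.length + a)),
    oneWord_append_lt_iff] at h1
  rcases h1 with h1 | ⟨h1, h2⟩
  · omega
  · simp at h2

theorem IsLyndon.eq_twoWord {w : List (Fin 2)} (hw : IsLyndon w) (h : w.count 1 = 2) :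
    ∃ a b, b < a ∧ w = twoWord a b := by
  obtain ⟨a, x, rfl⟩ := exists_eq_oneWord_append (by omega : 0 < w.count 1)
  rw [List.count_append, count_oneWord] at h
  obtain ⟨b, y, rfl⟩ := exists_eq_oneWord_append (by omega : 0 < x.count 1)
  rw [List.count_append, count_oneWord] at h
  have hy := eq_replicate_of_count_eq_zero (by omega : y.count 1 = 0)
  by_cases hy0 : y = []
  · subst hy0
    refine ⟨a, b, ?_, by simp [twoWord_eq]⟩
    have h1 := hw.2 _ _ (oneWord_ne_nil a) (by simpa using oneWord_ne_nil b) rfl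
    rw [List.append_nil, oneWord_append_lt_iff] at h1
    rcases h1 with h1 | ⟨rfl, h2⟩
    · exact h1
    · exact absurd h2 (lt_irrefl _)
  · have h1 := hw.2 (oneWord a ++ oneWord b) y (by simp [oneWord_ne_nil]) hy0
      (List.append_assoc _ _ _).symm
    rw [hy, ← List.append_assoc (List.replicate _ _), ← oneWord_add,
      oneWord_append_lt_iff] at h1
    rcases h1 with h1 | ⟨h1, h2⟩
    · omega
    · have := List.length_pos_iff.mpr hy0
      omega

/-- A nonempty suffix of a word that ends with `x_2` contains `x_2`. -/
theorem count_pos_of_append_eq {a : ℕ} {x u v : List (Fin 2)} (hv : v ≠ [])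
    (h : u ++ v = x ++ oneWord a) : 0 < v.count 1 := by
  have h1 := congrArg List.getLast? h
  rw [List.getLast?_append_of_ne_nil _ hv, oneWord, ← List.append_assoc,
    List.getLast?_append_of_ne_nil _ (by simp)] at h1
  exact List.count_pos_iff.mpr (List.mem_of_getLast? (by simpa using h1))

theorem isLyndon_oneWord (a : ℕ) : IsLyndon (oneWord a) := by
  refine ⟨oneWord_ne_nil a, fun u v hu hv h => ?_⟩
  have hc := count_pos_of_append_eq (x := []) hv h.symm
  have hcu : u.count 1 = 0 := by
    have := congrArg (List.count 1) h
    rw [List.count_append, count_oneWord] at this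
    omega
  obtain ⟨c, y, rfl⟩ := exists_eq_oneWord_append hc
  have hu' := eq_replicate_of_count_eq_zero hcu
  have hul := List.length_pos_iff.mpr hu
  rw [hu', ← List.append_assoc, ← oneWord_add, ← List.append_nil (oneWord a)] at h
  obtain ⟨rfl, -⟩ := oneWord_append_inj h
  rw [List.append_assoc, ← List.append_nil (oneWord _), List.append_nil (oneWord _),
    ← List.append_nil (oneWord (u.length + c)), oneWord_append_lt_iff]
  omega

theorem isLyndon_twoWord {a b : ℕ} (hab : b < a) : IsLyndon (twoWord a b) := by
  rw [twoWord_eq]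
  refine ⟨by simp [oneWord_ne_nil], fun u v hu hv h => ?_⟩
  have hc := count_pos_of_append_eq hv h.symm
  have ht := congrArg (List.count 1) h
  rw [List.count_append, List.count_append, count_oneWord, count_oneWord] at ht
  obtain ⟨c, y, rfl⟩ := exists_eq_oneWord_append hc
  suffices c < a by
    rw [List.append_assoc, oneWord_append_lt_iff]
    exact Or.inl this
  rcases Nat.eq_zero_or_pos (u.count 1) with hcu | hcu
  · rw [eq_replicate_of_count_eq_zero hcu, ← List.append_assoc, ← oneWord_add] at h
    have hul := List.length_pos_iff.mpr hu
    have := (oneWord_append_inj h).1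
    omega
  · obtain ⟨a', u', rfl⟩ := exists_eq_oneWord_append hcu
    rw [List.append_assoc] at h
    obtain ⟨haa, h'⟩ := oneWord_append_inj h
    have hcu' : u'.count 1 = 0 := by
      rw [List.count_append, count_oneWord] at ht
      omega
    rw [eq_replicate_of_count_eq_zero hcu', ← List.append_assoc, ← oneWord_add,
      ← List.append_nil (oneWord b)] at h'
    have := (oneWord_append_inj h').1
    omega

/-! ### Super-letters of degree one and two in `x_2` -/

theorem chi_oneWord (q : Fin 2 → Fin 2 → 𝕜ˣ) (a b : ℕ) :
    (chi q (wordDeg (oneWord a)) (wordDeg (oneWord b)) : 𝕜) =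
      (q 0 0 : 𝕜) ^ (a * b) * (q 0 1 : 𝕜) ^ a * (q 1 0 : 𝕜) ^ b * q 1 1 := by
  simp only [chi, Fin.prod_univ_two, wordDeg_oneWord, Matrix.cons_val_zero, Matrix.cons_val_one,
    ← Nat.cast_mul, mul_one, one_mul, zpow_natCast, zpow_one, Units.val_mul,
    Units.val_pow_eq_pow_val]
  ring

theorem wordDeg_zero : wordDeg [(0 : Fin 2)] = ![1, 0] := by
  funext i
  fin_cases i <;> simp [wordDeg]

theorem chi_zero_oneWord (q : Fin 2 → Fin 2 → 𝕜ˣ) (a : ℕ) :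
    (chi q (wordDeg [(0 : Fin 2)]) (wordDeg (oneWord a)) : 𝕜) = (q 0 0 : 𝕜) ^ a * q 0 1 := by
  simp [chi, Fin.prod_univ_two, wordDeg_oneWord, wordDeg_zero]

theorem chi_zero_twoWord (q : Fin 2 → Fin 2 → 𝕜ˣ) (a b : ℕ) :
    (chi q (wordDeg [(0 : Fin 2)]) (wordDeg (twoWord a b)) : 𝕜) =
      (q 0 0 : 𝕜) ^ (a + b) * (q 0 1 : 𝕜) ^ 2 := by
  rw [wordDeg_twoWord, wordDeg_zero]
  simp only [chi, Fin.prod_univ_two, Matrix.cons_val_zero, Matrix.cons_val_one, one_mul, zero_mul,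
    zpow_natCast, zpow_zero, mul_one, Units.val_mul, Units.val_pow_eq_pow_val]
  rfl

/-- The braided commutator `x_1 y - s y x_1` with `x_1`. It is the braided adjoint action on the
elements `y` with `χ(α_1, deg y) = s`. -/
noncomputable def braidedAd (q : Fin 2 → Fin 2 → 𝕜ˣ) (s : 𝕜) :
    NicholsAlgebra q →ₗ[𝕜] NicholsAlgebra q :=
  LinearMap.mulLeft 𝕜 (toNichols q (FreeAlgebra.ι 𝕜 0)) -
    s • LinearMap.mulRight 𝕜 (toNichols q (FreeAlgebra.ι 𝕜 0))

theorem braidedAd_apply (q : Fin 2 → Fin 2 → 𝕜ˣ) (s : 𝕜) (y : NicholsAlgebra q) :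
    braidedAd q s y = toNichols q (FreeAlgebra.ι 𝕜 0) * y -
      s • (y * toNichols q (FreeAlgebra.ι 𝕜 0)) := rfl

theorem braidedAd_mul (q : Fin 2 → Fin 2 → 𝕜ˣ) (s t : 𝕜) (y z : NicholsAlgebra q) :
    braidedAd q (s * t) (y * z) = braidedAd q s y * z + s • (y * braidedAd q t z) := by
  simp only [braidedAd_apply, sub_mul, mul_sub, smul_sub, smul_mul_assoc, mul_smul_comm, smul_smul,
    mul_assoc]
  abel

/-- The super-letter `u_a = [x_1^a x_2]`, that is, `(ad x_1)^a (x_2)`. -/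
noncomputable def oneLetter (q : Fin 2 → Fin 2 → 𝕜ˣ) (a : ℕ) : NicholsAlgebra q :=
  superLetter q (oneWord a)

theorem zero_cons_oneWord (a : ℕ) : oneWord (a + 1) = [0] ++ oneWord a := rfl

theorem oneLetter_zero (q : Fin 2 → Fin 2 → 𝕜ˣ) :
    oneLetter q 0 = toNichols q (FreeAlgebra.ι 𝕜 1) :=
  superLetter_singleton q 1

theorem oneLetter_succ (q : Fin 2 → Fin 2 → 𝕜ˣ) (a : ℕ) :
    oneLetter q (a + 1) = braidedAd q ((q 0 0 : 𝕜) ^ a * q 0 1) (oneLetter q a) := by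
  rw [oneLetter, zero_cons_oneWord, superLetter_append q (isLyndon_singleton 0)
    (isLyndon_oneWord a), superLetter_singleton, chi_zero_oneWord]
  · rfl
  · rintro i hi h
    have := h.pos
    simp at hi
    omega

theorem superLetter_twoWord_succ (q : Fin 2 → Fin 2 → 𝕜ˣ) {a b : ℕ} (hab : b < a) :
    superLetter q (twoWord (a + 1) b) =
      braidedAd q ((q 0 0 : 𝕜) ^ (a + b) * (q 0 1 : 𝕜) ^ 2) (superLetter q (twoWord a b)) := by
  have h : twoWord (a + 1) b = [0] ++ twoWord a b := rfl
  rw [h, superLetter_append q (isLyndon_singleton 0)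
    (isLyndon_twoWord hab), superLetter_singleton, chi_zero_twoWord]
  · rfl
  · rintro i hi h
    have := h.pos
    simp at hi
    omega

/-- The factor `χ(a α_1 + α_2, b α_1 + α_2)` by which `u_a` and `u_b` are commuted. -/
def commFactor (q : Fin 2 → Fin 2 → 𝕜ˣ) (a b : ℕ) : 𝕜 :=
  (q 0 0 : 𝕜) ^ (a * b) * (q 0 1 : 𝕜) ^ a * (q 1 0 : 𝕜) ^ b * q 1 1

theorem superLetter_twoWord_base (q : Fin 2 → Fin 2 → 𝕜ˣ) (b : ℕ) :
    superLetter q (twoWord (b + 1) b) = oneLetter q (b + 1) * oneLetter q b -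
      commFactor q (b + 1) b • (oneLetter q b * oneLetter q (b + 1)) := by
  rw [twoWord_eq, superLetter_append q (isLyndon_oneWord _) (isLyndon_oneWord _), chi_oneWord]
  · rfl
  · rintro i hi h
    have hpos := h.pos
    simp only [oneWord, List.length_append, List.length_replicate, List.length_singleton] at hi
    obtain ⟨j, hj⟩ := Nat.exists_eq_add_of_le (show i ≤ b + 1 by omega)
    have hd : (oneWord (b + 1) ++ oneWord b).drop i = oneWord j ++ oneWord b := by
      rw [hj, oneWord_add, List.append_assoc]
      exact List.drop_left' (by simp)
    have h2 := h.2
    rw [hd] at h2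
    have h3 := h2.2 _ _ (oneWord_ne_nil j) (oneWord_ne_nil b) rfl
    rw [oneWord_append_lt_iff] at h3
    rcases h3 with h3 | ⟨rfl, h3⟩
    · omega
    · exact lt_irrefl _ h3

/-- The span of the products `u_i u_j` with `i, j < k` and `i + j = m`. -/
def pairSpan (q : Fin 2 → Fin 2 → 𝕜ˣ) (k m : ℕ) : Submodule 𝕜 (NicholsAlgebra q) :=
  Submodule.span 𝕜 {y | ∃ i j, i < k ∧ j < k ∧ i + j = m ∧ y = oneLetter q i * oneLetter q j}

theorem mul_mem_pairSpan (q : Fin 2 → Fin 2 → 𝕜ˣ) {i j k m : ℕ} (hi : i < k) (hj : j < k)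
    (h : i + j = m) : oneLetter q i * oneLetter q j ∈ pairSpan q k m :=
  Submodule.subset_span ⟨i, j, hi, hj, h, rfl⟩

theorem pairSpan_mono (q : Fin 2 → Fin 2 → 𝕜ˣ) {k k' m : ℕ} (h : k ≤ k') :
    pairSpan q k m ≤ pairSpan q k' m := by
  refine Submodule.span_mono ?_
  rintro _ ⟨i, j, hi, hj, hm, rfl⟩
  exact ⟨i, j, by omega, by omega, hm, rfl⟩

theorem braidedAd_mul_oneLetter (q : Fin 2 → Fin 2 → 𝕜ˣ) (i j : ℕ) :
    braidedAd q ((q 0 0 : 𝕜) ^ (i + j) * (q 0 1 : 𝕜) ^ 2) (oneLetter q i * oneLetter q j) =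
      oneLetter q (i + 1) * oneLetter q j +
        ((q 0 0 : 𝕜) ^ i * q 0 1) • (oneLetter q i * oneLetter q (j + 1)) := by
  rw [oneLetter_succ, oneLetter_succ, ← braidedAd_mul]
  congr 2
  ring

theorem braidedAd_mem_pairSpan (q : Fin 2 → Fin 2 → 𝕜ˣ) {k m : ℕ} {y : NicholsAlgebra q}
    (hy : y ∈ pairSpan q k m) :
    braidedAd q ((q 0 0 : 𝕜) ^ m * (q 0 1 : 𝕜) ^ 2) y ∈ pairSpan q (k + 1) (m + 1) := by
  induction hy using Submodule.span_induction with
  | mem y hy =>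
    obtain ⟨i, j, hi, hj, rfl, rfl⟩ := hy
    rw [braidedAd_mul_oneLetter]
    exact Submodule.add_mem _ (mul_mem_pairSpan q (by omega) (by omega) (by omega))
      (Submodule.smul_mem _ _ (mul_mem_pairSpan q (by omega) (by omega) (by omega)))
  | zero => simp
  | add y z _ _ hy hz => rw [map_add]; exact Submodule.add_mem _ hy hz
  | smul c y _ hy => rw [map_smul]; exact Submodule.smul_mem _ _ hy

/-- The braided commutator of `u_a` and `u_b`. -/
noncomputable def pairComm (q : Fin 2 → Fin 2 → 𝕜ˣ) (a b : ℕ) : NicholsAlgebra q :=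
  oneLetter q a * oneLetter q b - commFactor q a b • (oneLetter q b * oneLetter q a)

theorem commFactor_succ_left (q : Fin 2 → Fin 2 → 𝕜ˣ) (a b : ℕ) :
    commFactor q (a + 1) b = (q 0 0 : 𝕜) ^ b * q 0 1 * commFactor q a b := by
  simp only [commFactor]
  ring

/-- Applying `ad x_1` to a relation for the braided commutator of `u_a` and `u_b` gives one for
that of `u_{a+1}` and `u_b`. -/
theorem braidedAd_pairComm (q : Fin 2 → Fin 2 → 𝕜ˣ) {a b : ℕ} (hab : b < a) :
    braidedAd q ((q 0 0 : 𝕜) ^ (a + b) * (q 0 1 : 𝕜) ^ 2) (pairComm q a b) - pairComm q (a + 1) b ∈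
      pairSpan q (a + 1) (a + 1 + b) := by
  have h : braidedAd q ((q 0 0 : 𝕜) ^ (a + b) * (q 0 1 : 𝕜) ^ 2) (pairComm q a b) -
      pairComm q (a + 1) b = ((q 0 0 : 𝕜) ^ a * q 0 1) • (oneLetter q a * oneLetter q (b + 1)) -
        commFactor q a b • (oneLetter q (b + 1) * oneLetter q a) := by
    rw [pairComm, map_sub, map_smul, braidedAd_mul_oneLetter, add_comm a b,
      braidedAd_mul_oneLetter, pairComm, commFactor_succ_left]
    module
  rw [h]
  exact Submodule.sub_mem _
    (Submodule.smul_mem _ _ (mul_mem_pairSpan q (by omega) (by omega) (by omega)))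
    (Submodule.smul_mem _ _ (mul_mem_pairSpan q (by omega) (by omega) (by omega)))

/-- Modulo products of smaller `u_i`, the super-letter `[x_1^a x_2 x_1^b x_2]` is the braided
commutator of `u_a` and `u_b`. -/
theorem superLetter_twoWord_sub_mem (q : Fin 2 → Fin 2 → 𝕜ˣ) {a b : ℕ} (hab : b < a) :
    superLetter q (twoWord a b) - pairComm q a b ∈ pairSpan q a (a + b) := by
  induction a, hab using Nat.le_induction with
  | base => rw [superLetter_twoWord_base, pairComm, sub_self]; exact Submodule.zero_mem _
  | succ a hab ih =>
    have h1 := Submodule.add_mem _ (braidedAd_mem_pairSpan q ih) (add_right_comm a b 1 ▸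
      braidedAd_pairComm q hab)
    rw [map_sub, ← superLetter_twoWord_succ q hab, sub_add_sub_cancel] at h1
    rwa [add_right_comm] at h1

theorem superLetter_twoWord_mem (q : Fin 2 → Fin 2 → 𝕜ˣ) {a b k : ℕ} (hab : b < a) (hk : a < k) :
    superLetter q (twoWord a b) ∈ pairSpan q k (a + b) := by
  rw [← sub_add_cancel (superLetter q (twoWord a b)) (pairComm q a b)]
  refine Submodule.add_mem _ (pairSpan_mono q hk.le (superLetter_twoWord_sub_mem q hab)) ?_
  exact Submodule.sub_mem _ (mul_mem_pairSpan q (by omega) (by omega) (by omega))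
    (Submodule.smul_mem _ _ (mul_mem_pairSpan q (by omega) (by omega) (by omega)))

/-! ### The skew derivation `∂_1` on products `u_i u_j` -/

/-- The lift of `u_a` to the tensor algebra. -/
noncomputable def oneLift (q : Fin 2 → Fin 2 → 𝕜ˣ) : ℕ → FreeAlgebra 𝕜 (Fin 2)
  | 0 => FreeAlgebra.ι 𝕜 1
  | a + 1 => FreeAlgebra.ι 𝕜 0 * oneLift q a -
      ((q 0 0 : 𝕜) ^ a * q 0 1) • (oneLift q a * FreeAlgebra.ι 𝕜 0)

theorem toNichols_oneLift (q : Fin 2 → Fin 2 → 𝕜ˣ) (a : ℕ) :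
    toNichols q (oneLift q a) = oneLetter q a := by
  induction a with
  | zero => rw [oneLetter_zero, oneLift]
  | succ a ih =>
    rw [oneLetter_succ, oneLift, braidedAd_apply, map_sub, map_smul, map_mul, map_mul, ih]

theorem twist_oneLift (q : Fin 2 → Fin 2 → 𝕜ˣ) (a : ℕ) :
    twist q 0 (oneLift q a) = ((q 0 0 : 𝕜) ^ a * q 1 0) • oneLift q a := by
  induction a with
  | zero => simp [oneLift, twist_ι]
  | succ a ih =>
    rw [oneLift, map_sub, map_smul, map_mul, map_mul, ih, twist_ι]
    simp only [smul_mul_assoc, mul_smul_comm]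
    module

/-- The scalar `(a)_p (1 - p^(a-1) q_12 q_21)`, `p = q_11`, by which `∂_1` sends `u_a` to
a multiple of `u_{a-1}`. -/
def derivFactor (q : Fin 2 → Fin 2 → 𝕜ˣ) : ℕ → 𝕜
  | 0 => 0
  | a + 1 => 1 - (q 0 0 : 𝕜) ^ (2 * a) * (q 0 1 * q 1 0) + q 0 0 * derivFactor q a

theorem skewDeriv_ι (q : Fin 2 → Fin 2 → 𝕜ˣ) (i j : Fin 2) :
    skewDeriv q i (FreeAlgebra.ι 𝕜 j) = if j = i then 1 else 0 := by
  rw [← mul_one (FreeAlgebra.ι 𝕜 j), skewDeriv_ι_mul, skewDeriv_one]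
  simp

theorem skewDeriv_zero_oneLift (q : Fin 2 → Fin 2 → 𝕜ˣ) (a : ℕ) :
    skewDeriv q 0 (oneLift q a) = derivFactor q a • oneLift q (a - 1) := by
  induction a with
  | zero => simp [oneLift, skewDeriv_ι, derivFactor]
  | succ a ih =>
    rw [oneLift, map_sub, map_smul, skewDeriv_ι_mul, skewDeriv_mul, twist_oneLift, skewDeriv_ι,
      if_pos rfl, if_pos rfl, ih, mul_one, Nat.add_sub_cancel, derivFactor]
    cases a with
    | zero =>
      simp only [derivFactor, zero_smul, mul_zero, zero_mul, smul_zero]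
      module
    | succ a =>
      simp only [Nat.add_sub_cancel, mul_smul_comm, smul_mul_assoc]
      rw [oneLift]
      module

theorem skewDeriv_one_oneLift (q : Fin 2 → Fin 2 → 𝕜ˣ) (a : ℕ) :
    skewDeriv q 1 (oneLift q (a + 1)) = 0 := by
  induction a with
  | zero =>
    rw [oneLift, oneLift, map_sub, map_smul, skewDeriv_ι_mul, skewDeriv_mul, skewDeriv_ι,
      skewDeriv_ι]
    simp
  | succ a ih =>
    rw [oneLift, map_sub, map_smul, skewDeriv_ι_mul, skewDeriv_mul, ih, skewDeriv_ι]
    simp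

theorem algebraMapInv_oneLift (q : Fin 2 → Fin 2 → 𝕜ˣ) (a : ℕ) :
    FreeAlgebra.algebraMapInv (oneLift q a) = (0 : 𝕜) := by
  cases a <;> simp [oneLift, FreeAlgebra.algebraMapInv]

/-- If `∂_1` kills the lift of `u_l`, `l ≥ 1`, then so do all skew derivations, since `∂_2` always
does. Hence `u_l = 0`, and all later `u_k` vanish with it. -/
theorem oneLetter_eq_zero_of_derivFactor (q : Fin 2 → Fin 2 → 𝕜ˣ) {l : ℕ} (hl : 1 ≤ l)
    (h : derivFactor q l = 0) {k : ℕ} (hk : l ≤ k) : oneLetter q k = 0 := by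
  induction k, hk using Nat.le_induction with
  | base =>
    obtain ⟨l, rfl⟩ := Nat.exists_eq_add_of_le' hl
    rw [← toNichols_oneLift]
    refine toNichols_eq_zero_of_skewDeriv q (algebraMapInv_oneLift q _) fun i => ?_
    fin_cases i
    · simp [skewDeriv_zero_oneLift, h]
    · simp [skewDeriv_one_oneLift]
  | succ k _ ih => rw [oneLetter_succ, ih, map_zero]

theorem skewDeriv_mul_oneLift (q : Fin 2 → Fin 2 → 𝕜ˣ) (i j : ℕ) :
    toNichols q (skewDeriv q 0 (oneLift q i * oneLift q j)) =
      derivFactor q i • (oneLetter q (i - 1) * oneLetter q j) +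
        ((q 0 0 : 𝕜) ^ i * q 1 0 * derivFactor q j) • (oneLetter q i * oneLetter q (j - 1)) := by
  rw [skewDeriv_mul, skewDeriv_zero_oneLift, skewDeriv_zero_oneLift, twist_oneLift]
  simp only [map_add, map_mul, map_smul, toNichols_oneLift, smul_mul_assoc, mul_smul_comm,
    smul_smul]
  congr 2
  ring

/-- The skew derivation `∂_1` maps combinations of products `u_i u_j` with `i, j < k` to such
combinations. This is expressed with lifts to the tensor algebra, where `∂_1` is defined. -/
theorem exists_lift_of_mem_pairSpan (q : Fin 2 → Fin 2 → 𝕜ˣ) {k m : ℕ} {y : NicholsAlgebra q}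
    (hy : y ∈ pairSpan q k (m + 1)) :
    ∃ a, toNichols q a = y ∧ toNichols q (skewDeriv q 0 a) ∈ pairSpan q k m := by
  induction hy using Submodule.span_induction with
  | mem y hy =>
    obtain ⟨i, j, hi, hj, hm, rfl⟩ := hy
    refine ⟨oneLift q i * oneLift q j, by rw [map_mul, toNichols_oneLift, toNichols_oneLift], ?_⟩
    rw [skewDeriv_mul_oneLift]
    refine Submodule.add_mem _ ?_ ?_
    · cases i with
      | zero => simp [derivFactor]
      | succ i =>
        exact Submodule.smul_mem _ _ (mul_mem_pairSpan q (by omega) hj (by omega))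
    · cases j with
      | zero => simp [derivFactor]
      | succ j =>
        exact Submodule.smul_mem _ _ (mul_mem_pairSpan q hi (by omega) (by omega))
  | zero => exact ⟨0, by simp, by simp⟩
  | add y z _ _ hy hz =>
    obtain ⟨a, rfl, ha⟩ := hy
    obtain ⟨b, rfl, hb⟩ := hz
    exact ⟨a + b, map_add _ _ _, by simpa only [map_add] using Submodule.add_mem _ ha hb⟩
  | smul c y _ hy =>
    obtain ⟨a, rfl, ha⟩ := hy
    exact ⟨c • a, map_smul _ _ _, by simpa only [map_smul] using Submodule.smul_mem _ c ha⟩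

/-- A relation for the braided commutator of `u_{k+1}` and `u_l` gives, by the skew derivation
`∂_1`, one for that of `u_{k+1}` and `u_{l-1}`. -/
theorem pairComm_pred_mem (q : Fin 2 → Fin 2 → 𝕜ˣ) {k l : ℕ} (hlk : l + 1 ≤ k)
    (h : pairComm q (k + 1) (l + 1) ∈ pairSpan q (k + 1) (k + l + 1 + 1)) :
    pairComm q (k + 1) l ∈ pairSpan q (k + 1) (k + l + 1) := by
  -- If `∂_1` kills `u_{l+1}`, then `u_{k+1} = 0` and there is nothing to show. Otherwise the factor
  -- of the commutator in the derived relation is invertible.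
  by_cases hd : derivFactor q (l + 1) = 0
  · have h0 := oneLetter_eq_zero_of_derivFactor q (by omega) hd (show l + 1 ≤ k + 1 by omega)
    rw [pairComm, h0, zero_mul, mul_zero, smul_zero, sub_zero]
    exact Submodule.zero_mem _
  obtain ⟨a, ha, haD⟩ := exists_lift_of_mem_pairSpan q h
  have h1 : toNichols q (oneLift q (k + 1) * oneLift q (l + 1) -
      commFactor q (k + 1) (l + 1) • (oneLift q (l + 1) * oneLift q (k + 1)) - a) = 0 := by
    simp only [map_sub, map_smul, map_mul, toNichols_oneLift, ha]
    exact sub_self _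
  have h2 := toNichols_skewDeriv_eq_zero q 0 h1
  rw [map_sub, map_sub, sub_eq_zero] at h2
  rw [← h2, map_sub, map_smul, map_sub, map_smul, skewDeriv_mul_oneLift, skewDeriv_mul_oneLift,
    Nat.add_sub_cancel, Nat.add_sub_cancel] at haD
  set s : 𝕜 := (q 0 0 : 𝕜) ^ (k + 1) * q 1 0 * derivFactor q (l + 1) with hs
  have hs0 : s ≠ 0 := by
    simp [hs, hd]
  -- The coefficient of `u_l u_{k+1}` is the one that makes a braided commutator again.
  have hc : commFactor q (k + 1) (l + 1) * derivFactor q (l + 1) = s * commFactor q (k + 1) l := by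
    simp only [hs, commFactor]
    ring
  have h3 : s • pairComm q (k + 1) l ∈ pairSpan q (k + 1) (k + l + 1) := by
    have e : s • pairComm q (k + 1) l =
        (derivFactor q (k + 1) • (oneLetter q k * oneLetter q (l + 1)) +
          s • (oneLetter q (k + 1) * oneLetter q l) -
        commFactor q (k + 1) (l + 1) •
          (derivFactor q (l + 1) • (oneLetter q l * oneLetter q (k + 1)) +
            ((q 0 0 : 𝕜) ^ (l + 1) * q 1 0 * derivFactor q (k + 1)) •
              (oneLetter q (l + 1) * oneLetter q k))) -
        derivFactor q (k + 1) • (oneLetter q k * oneLetter q (l + 1)) +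
        (commFactor q (k + 1) (l + 1) * ((q 0 0 : 𝕜) ^ (l + 1) * q 1 0 * derivFactor q (k + 1))) •
              (oneLetter q (l + 1) * oneLetter q k) := by
      rw [pairComm, smul_sub, smul_smul, ← hc]
      module
    rw [e]
    refine Submodule.add_mem _ (Submodule.sub_mem _ haD ?_) ?_ <;>
    exact Submodule.smul_mem _ _ (mul_mem_pairSpan q (by omega) (by omega) (by omega))
  exact (Submodule.smul_mem_iff _ hs0).mp h3

/-! ### Monomials in larger root vector candidates -/

theorem wordPow_one {n : ℕ} (w : List (Fin n)) : wordPow w 1 = w := by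
  simp [wordPow]

theorem count_wordPow {n : ℕ} (w : List (Fin n)) (k : ℕ) (i : Fin n) :
    (wordPow w k).count i = k * w.count i := by
  simp [wordPow, List.count_flatten]

theorem isRootVectorCandidate_of_isLyndon {n : ℕ} (q : Fin n → Fin n → 𝕜ˣ) {w : List (Fin n)}
    (hw : IsLyndon w) : IsRootVectorCandidate q w :=
  ⟨w, 1, hw, Or.inl rfl, (wordPow_one w).symm⟩

theorem bracket_of_isLyndon {n : ℕ} (q : Fin n → Fin n → 𝕜ˣ) {w : List (Fin n)}
    (hw : IsLyndon w) : bracket q w = superLetter q w := by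
  have h := bracket_wordPow q hw one_pos
  rwa [wordPow_one, pow_one] at h

/-- Every monomial in root vector candidates larger than `w` is a product of super-letters of Lyndon
words `v`, each of which has a power `v^t` that exceeds `w` and occurs in the product. -/
theorem exists_flatten_of_mem_largerMonomials (q : Fin 2 → Fin 2 → 𝕜ˣ) {w : List (Fin 2)}
    {y : NicholsAlgebra q} (hy : y ∈ largerMonomials q w) :
    ∃ N : List (List (Fin 2)), y = (N.map (superLetter q)).prod ∧ ∀ v ∈ N, IsLyndon v ∧
      ∃ t, 0 < t ∧ w < wordPow v t ∧ t * v.count 1 ≤ N.flatten.count 1 := by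
  obtain ⟨L, hL, -, rfl⟩ := hy
  induction L with
  | nil => exact ⟨[], by simp, by simp⟩
  | cons p L ih =>
    obtain ⟨N, hN, hNv⟩ := ih fun p' hp' => hL p' (List.mem_cons_of_mem _ hp')
    obtain ⟨⟨v, t, hv, -, hvt⟩, hlt⟩ := hL p List.mem_cons_self
    have ht : 0 < t := by
      rcases Nat.eq_zero_or_pos t with rfl | ht
      · rw [hvt] at hlt
        simp [wordPow] at hlt
      · exact ht
    have hc : (List.replicate (t * p.2) v ++ N).flatten.count 1 =
        t * p.2 * v.count 1 + N.flatten.count 1 := by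
      simp [List.count_flatten]
    refine ⟨List.replicate (t * p.2) v ++ N, ?_, fun v' hv' => ?_⟩
    · rw [List.map_cons, List.prod_cons, hN, hvt, bracket_wordPow q hv ht]
      simp [pow_mul]
    · rw [hc]
      rcases List.mem_append.mp hv' with hv' | hv'
      · rw [List.mem_replicate] at hv'
        obtain ⟨h0, rfl⟩ := hv'
        have hp : 1 ≤ p.2 := Nat.pos_of_ne_zero (right_ne_zero_of_mul h0)
        refine ⟨hv, t, ht, hvt ▸ hlt, ?_⟩
        calc t * v'.count 1 = t * 1 * v'.count 1 := by rw [mul_one]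
          _ ≤ t * p.2 * v'.count 1 := by gcongr
          _ ≤ _ := Nat.le_add_right _ _
      · obtain ⟨h1, s, hs, hs1, hs2⟩ := hNv v' hv'
        exact ⟨h1, s, hs, hs1, by omega⟩

theorem lt_of_twoWord_lt_wordPow_oneWord {k l a t : ℕ} (hlk : l ≤ k) (ht : 0 < t) (ht2 : t ≤ 2)
    (h : twoWord k l < wordPow (oneWord a) t) : a < k := by
  rw [twoWord_eq] at h
  obtain rfl | rfl : t = 1 ∨ t = 2 := by omega
  · rw [wordPow_one, ← List.append_nil (oneWord a), oneWord_append_lt_iff] at h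
    rcases h with h | ⟨-, h⟩
    · exact h
    · simp at h
  · rw [wordPow_succ, wordPow_one, oneWord_append_lt_iff] at h
    rcases h with h | ⟨rfl, h⟩
    · exact h
    · rw [← List.append_nil (oneWord l), ← List.append_nil (oneWord k),
        oneWord_append_lt_iff] at h
      rcases h with h | ⟨-, h⟩
      · omega
      · simp at h

theorem twoWord_lt_iff {a b k l : ℕ} (h : a + b = k + l) :
    twoWord k l < twoWord a b ↔ a < k := by
  rw [twoWord_eq, twoWord_eq, oneWord_append_lt_iff]
  refine ⟨?_, Or.inl⟩
  rintro (h1 | ⟨rfl, h1⟩)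
  · exact h1
  · obtain rfl : b = l := by omega
    exact absurd h1 (lt_irrefl _)

/-- Among the products of super-letters that are monomials in root vector candidates larger than
`x_1^k x_2 x_1^l x_2`, those of the degree of this word lie in the span of the `u_i u_j` with
`i, j < k`. -/
theorem prod_superLetter_mem_pairSpan (q : Fin 2 → Fin 2 → 𝕜ˣ) {k l : ℕ} (hlk : l ≤ k)
    {N : List (List (Fin 2))}
    (hN : ∀ v ∈ N, IsLyndon v ∧
      ∃ t, 0 < t ∧ twoWord k l < wordPow v t ∧ t * v.count 1 ≤ N.flatten.count 1)
    (hdeg : wordDeg N.flatten = wordDeg (twoWord k l)) :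
    (N.map (superLetter q)).prod ∈ pairSpan q k (k + l) := by
  have hd1 : N.flatten.count 1 = 2 := by
    have := congrFun hdeg 1
    rw [wordDeg_twoWord] at this
    simp only [wordDeg, Matrix.cons_val_one, Matrix.cons_val_fin_one] at this
    exact_mod_cast this
  have hpos : ∀ v ∈ N, 0 < v.count 1 := by
    intro v hv
    obtain ⟨-, t, -, hlt, -⟩ := hN v hv
    by_contra h0
    have h1 : (wordPow v t).count 1 = 0 := by rw [count_wordPow]; simp; omega
    rw [eq_replicate_of_count_eq_zero h1, twoWord_eq] at hlt
    exact not_oneWord_append_lt_replicate _ _ _ hlt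
  rw [hd1] at hN
  match N, hN, hd1, hpos, hdeg with
  | [], _, hd1, _, _ => simp at hd1
  | [v], hN, hd1, _, hdeg =>
    obtain ⟨hv, t, ht, hlt, hle⟩ := hN v (by simp)
    simp only [List.flatten_cons, List.flatten_nil, List.append_nil] at hd1 hdeg
    obtain ⟨a, b, hab, rfl⟩ := hv.eq_twoWord hd1
    rw [hd1] at hle
    obtain rfl : t = 1 := by omega
    have hm : a + b = k + l := by
      have := congrFun hdeg 0
      rw [wordDeg_twoWord, wordDeg_twoWord] at this
      have h0 : (a : ℤ) + b = k + l := by simpa using this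
      omega
    rw [wordPow_one, twoWord_lt_iff hm] at hlt
    rw [← hm]
    simpa using superLetter_twoWord_mem q hab hlt
  | [v, v'], hN, hd1, hpos, hdeg =>
    obtain ⟨hv, t, ht, hlt, hle⟩ := hN v (by simp)
    obtain ⟨hv', t', ht', hlt', hle'⟩ := hN v' (by simp)
    have hp := hpos v (by simp)
    have hp' := hpos v' (by simp)
    simp only [List.flatten_cons, List.flatten_nil, List.append_nil, List.count_append] at hd1 hdeg
    have h1 : v.count 1 = 1 := by omega
    have h1' : v'.count 1 = 1 := by omega
    obtain ⟨a, rfl⟩ := hv.eq_oneWord h1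
    obtain ⟨b, rfl⟩ := hv'.eq_oneWord h1'
    rw [h1, mul_one] at hle
    rw [h1', mul_one] at hle'
    have hm : a + b = k + l := by
      have := congrFun hdeg 0
      rw [wordDeg_append, wordDeg_oneWord, wordDeg_oneWord, wordDeg_twoWord] at this
      have h0 : (a : ℤ) + b = k + l := by simpa using this
      omega
    simpa [oneLetter] using mul_mem_pairSpan q (lt_of_twoWord_lt_wordPow_oneWord hlk ht hle hlt)
      (lt_of_twoWord_lt_wordPow_oneWord hlk ht' hle' hlt') hm
  | v :: v' :: v'' :: N, _, hd1, hpos, _ =>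
    have h1 := hpos v (by simp)
    have h2 := hpos v' (by simp)
    have h3 := hpos v'' (by simp)
    simp only [List.flatten_cons, List.count_append] at hd1
    omega

theorem mem_pairSpan_of_mem_span_largerMonomials (q : Fin 2 → Fin 2 → 𝕜ˣ) {k l : ℕ}
    (hlk : l ≤ k) {x : NicholsAlgebra q}
    (hx : x ∈ Submodule.span 𝕜 (largerMonomials q (twoWord k l)))
    (hd : ∃ a ∈ homogeneous 𝕜 (wordDeg (twoWord k l)), toNichols q a = x) :
    x ∈ pairSpan q k (k + l) := by
  refine mem_of_mem_span_homogeneous q (fun y hy => ?_) hx hd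
  obtain ⟨N, rfl, hN⟩ := exists_flatten_of_mem_largerMonomials q hy
  obtain ⟨a, ha, hae⟩ := prod_superLetter_homogeneous q N
  exact ⟨_, a, ha, hae, prod_superLetter_mem_pairSpan q hlk hN⟩

theorem superLetter_mem_largerMonomials {n : ℕ} (q : Fin n → Fin n → 𝕜ˣ) {v w : List (Fin n)}
    (hv : IsLyndon v) (h : w < v) : superLetter q v ∈ largerMonomials q w :=
  ⟨[(v, 1)], by simpa using ⟨isRootVectorCandidate_of_isLyndon q hv, h⟩, by simp,
    by simp [bracket_of_isLyndon q hv]⟩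

theorem oneLetter_mul_mem_largerMonomials (q : Fin 2 → Fin 2 → 𝕜ˣ) {i j k l : ℕ} (hij : i ≤ j)
    (hj : j < k) : oneLetter q i * oneLetter q j ∈ largerMonomials q (twoWord k l) := by
  have hlt : ∀ a < k, twoWord k l < oneWord a := fun a ha => by
    rw [twoWord_eq, ← List.append_nil (oneWord a), oneWord_append_lt_iff]
    exact Or.inl ha
  have hc := fun a => isRootVectorCandidate_of_isLyndon q (isLyndon_oneWord a)
  rcases hij.eq_or_lt with rfl | hij
  · exact ⟨[(oneWord i, 2)], by simpa using ⟨hc i, hlt i hj⟩, by simp,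
      by simp [bracket_of_isLyndon q (isLyndon_oneWord i), oneLetter, pow_two]⟩
  · refine ⟨[(oneWord i, 1), (oneWord j, 1)], ?_, ?_, ?_⟩
    · simpa using ⟨⟨hc i, hlt i (hij.trans hj)⟩, hc j, hlt j hj⟩
    · have : oneWord j < oneWord i := by
        rw [← List.append_nil (oneWord i), ← List.append_nil (oneWord j), oneWord_append_lt_iff]
        exact Or.inl hij
      simpa using this
    · simp [bracket_of_isLyndon q (isLyndon_oneWord _), oneLetter]

/-- A product `u_i u_j` with `i ≤ j` is a monomial of the required form. For `j < i` it is, up to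
the product `u_j u_i` and products of smaller `u`, the super-letter `[x_1^i x_2 x_1^j x_2]`. -/
theorem pairSpan_le_span_largerMonomials (q : Fin 2 → Fin 2 → 𝕜ˣ) {k l t : ℕ} (ht : t ≤ k) :
    pairSpan q t (k + l) ≤ Submodule.span 𝕜 (largerMonomials q (twoWord k l)) := by
  induction t with
  | zero =>
    refine Submodule.span_le.mpr ?_
    rintro _ ⟨i, j, hi, -⟩
    omega
  | succ t ih =>
    refine Submodule.span_le.mpr ?_
    rintro _ ⟨i, j, hi, hj, hm, rfl⟩
    rcases le_or_gt i j with hij | hij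
    · exact Submodule.subset_span (oneLetter_mul_mem_largerMonomials q hij (by omega))
    · have h1 := pairSpan_mono q (show i ≤ t by omega) (superLetter_twoWord_sub_mem q hij)
      rw [hm] at h1
      have h2 : superLetter q (twoWord i j) ∈ largerMonomials q (twoWord k l) :=
        superLetter_mem_largerMonomials q (isLyndon_twoWord hij)
          ((twoWord_lt_iff hm).mpr (by omega))
      have h3 := oneLetter_mul_mem_largerMonomials q (l := l) hij.le (show i < k by omega)
      have e : oneLetter q i * oneLetter q j = superLetter q (twoWord i j) -
          (superLetter q (twoWord i j) - pairComm q i j) +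
            commFactor q i j • (oneLetter q j * oneLetter q i) := by
        rw [pairComm]; abel
      rw [e]
      exact Submodule.add_mem _ (Submodule.sub_mem _ (Submodule.subset_span h2)
        (ih (by omega) h1)) (Submodule.smul_mem _ _ (Submodule.subset_span h3))

/-! ### Root vectors -/

/-- The condition to be a root vector, in terms of the elements `u_i` only. -/
theorem not_isRootVector_twoWord_iff (q : Fin 2 → Fin 2 → 𝕜ˣ) {k l : ℕ} (hlk : l < k) :
    ¬ IsRootVector q (twoWord k l) ↔ pairComm q k l ∈ pairSpan q k (k + l) := by
  have hL := isLyndon_twoWord hlk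
  have hd := superLetter_twoWord_sub_mem q hlk
  rw [IsRootVector, bracket_of_isLyndon q hL]
  simp only [isRootVectorCandidate_of_isLyndon q hL, true_and, not_not]
  constructor
  · intro h
    have h1 := mem_pairSpan_of_mem_span_largerMonomials q hlk.le h (superLetter_homogeneous q _)
    simpa using Submodule.sub_mem _ h1 hd
  · intro h
    have h1 := Submodule.add_mem _ hd h
    rw [sub_add_cancel] at h1
    exact pairSpan_le_span_largerMonomials q le_rfl h1

theorem twoWord_self (k : ℕ) : twoWord k k = wordPow (oneWord k) 2 := by
  rw [twoWord_eq, wordPow_succ, wordPow_one]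

/-- Also in characteristic two, where `2` is a height if `χ(α, α) = 1 = -1`. -/
theorem eq_neg_one_of_two_mem_heights {n : ℕ} (q : Fin n → Fin n → 𝕜ˣ) {α : Fin n → ℤ}
    (h : 2 ∈ heights q α) : (chi q α α : 𝕜) = -1 := by
  have key : orderOf (chi q α α) = 2 → (chi q α α : 𝕜) = -1 := by
    intro ho
    have h1 : (chi q α α : 𝕜) ^ 2 = 1 := by
      rw [← Units.val_pow_eq_pow_val, ← ho, pow_orderOf_eq_one, Units.val_one]
    rw [pow_two, mul_self_eq_one_iff] at h1
    refine h1.resolve_left fun h2 => ?_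
    rw [Units.val_eq_one] at h2
    rw [h2, orderOf_one] at ho
    omega
  rcases h with h | ⟨-, ⟨-, h⟩ | ⟨hp, j, h⟩⟩
  · omega
  · exact key h.symm
  · cases j with
    | zero => exact key (by simpa using h.symm)
    | succ j =>
      have hp1 : ringChar 𝕜 ≠ 1 := CharP.ringChar_ne_one
      have hdvd : ringChar 𝕜 ∣ 2 := h ▸ (dvd_pow_self _ (by omega)).mul_left _
      have h2 : ringChar 𝕜 = 2 := ((Nat.dvd_prime Nat.prime_two).mp hdvd).resolve_left hp1
      have ho : orderOf (chi q α α) = 1 := by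
        rw [h2, pow_succ] at h
        have := Nat.pos_of_ne_zero (fun h0 => by simp [h0] at h : orderOf (chi q α α) ≠ 0)
        have := Nat.one_le_two_pow (n := j)
        nlinarith
      have : CharP 𝕜 2 := h2 ▸ ringChar.charP 𝕜
      rw [orderOf_eq_one_iff.mp ho, Units.val_one, CharTwo.neg_eq]

/-- If `(x_1^k x_2)^2` is a root vector candidate, then `χ(α, α) = -1` for `α = k α_1 + α_2`. -/
theorem commFactor_self_eq_neg_one (q : Fin 2 → Fin 2 → 𝕜ˣ) {k : ℕ}
    (h : IsRootVectorCandidate q (twoWord k k)) : commFactor q k k = -1 := by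
  obtain ⟨v, t, hv, ht, hvt⟩ := h
  rw [twoWord_self] at hvt
  have ht0 : 0 < t := by
    rcases Nat.eq_zero_or_pos t with rfl | ht
    · simp [wordPow, oneWord_ne_nil] at hvt
    · exact ht
  obtain ⟨rfl, rfl⟩ := lyndon_root_unique (isLyndon_oneWord k) hv two_pos ht0 hvt
  rw [commFactor, ← chi_oneWord]
  exact eq_neg_one_of_two_mem_heights q ht

/-- Applying `ad x_1` to the relation that makes `[x_1^k x_2 x_1^l x_2]` redundant. -/
theorem pairComm_succ_mem_of_not_isRootVector (q : Fin 2 → Fin 2 → 𝕜ˣ) {k l : ℕ} (hlk : l ≤ k)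
    (hc : IsRootVectorCandidate q (twoWord k l)) (h : ¬ IsRootVector q (twoWord k l)) :
    pairComm q (k + 1) l ∈ pairSpan q (k + 1) (k + l + 1) := by
  rcases hlk.eq_or_lt with rfl | hlk
  · have hs : bracket q (twoWord l l) = oneLetter q l * oneLetter q l := by
      rw [twoWord_self, bracket_wordPow q (isLyndon_oneWord l) two_pos, pow_two, oneLetter]
    have h1 : bracket q (twoWord l l) ∈ Submodule.span 𝕜 (largerMonomials q (twoWord l l)) := by
      by_contra h'
      exact h ⟨hc, h'⟩
    have h2 := prod_superLetter_homogeneous q [oneWord l, oneWord l]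
    rw [hs] at h1
    have h3 := mem_pairSpan_of_mem_span_largerMonomials q le_rfl h1
      (by simpa [twoWord_eq, oneLetter] using h2)
    have h4 := braidedAd_mem_pairSpan q h3
    rw [braidedAd_mul_oneLetter] at h4
    rw [pairComm, commFactor_succ_left, commFactor_self_eq_neg_one q hc]
    convert h4 using 1
    module
  · have h1 := braidedAd_mem_pairSpan q ((not_isRootVector_twoWord_iff q hlk).mp h)
    have h2 := braidedAd_pairComm q hlk
    rw [add_right_comm] at h2
    simpa using Submodule.sub_mem _ h1 h2

theorem not_isRootVector_twoWord_succ (q : Fin 2 → Fin 2 → 𝕜ˣ) {k l : ℕ} (hlk : l + 1 ≤ k)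
    (hc : IsRootVectorCandidate q (twoWord k (l + 1)))
    (h : ¬ IsRootVector q (twoWord k (l + 1))) : ¬ IsRootVector q (twoWord (k + 1) l) := by
  have h1 := pairComm_succ_mem_of_not_isRootVector q hlk hc h
  rw [← add_assoc] at h1
  have h2 := pairComm_pred_mem q hlk h1
  rw [add_right_comm] at h2
  exact (not_isRootVector_twoWord_iff q (by omega)).mpr h2

theorem IsRootVectorCandidate.eq_twoWord {q : Fin 2 → Fin 2 → 𝕜ˣ} {w : List (Fin 2)}
    (hc : IsRootVectorCandidate q w) {m : ℕ} (hw : wordDeg w = ![(m : ℤ), 2]) :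
    ∃ a b, b ≤ a ∧ a + b = m ∧ w = twoWord a b := by
  have hcount : w.count 1 = 2 := by
    have := congrFun hw 1
    simp only [wordDeg, Matrix.cons_val_one, Matrix.cons_val_fin_one] at this
    exact_mod_cast this
  suffices ∃ a b, b ≤ a ∧ w = twoWord a b by
    obtain ⟨a, b, hab, rfl⟩ := this
    refine ⟨a, b, hab, ?_, rfl⟩
    have := congrFun hw 0
    rw [wordDeg_twoWord] at this
    have h0 : (a : ℤ) + b = m := by simpa using this
    omega
  obtain ⟨v, t, hv, -, rfl⟩ := hc
  rw [count_wordPow] at hcount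
  rcases (Nat.dvd_prime Nat.prime_two).mp ⟨_, hcount.symm⟩ with rfl | rfl
  · obtain ⟨a, b, hab, rfl⟩ := hv.eq_twoWord (by omega)
    exact ⟨a, b, hab.le, wordPow_one _⟩
  · obtain ⟨a, rfl⟩ := hv.eq_oneWord (by omega)
    exact ⟨a, a, le_rfl, (twoWord_self a).symm⟩

theorem not_isRootVector_twoWord_add (q : Fin 2 → Fin 2 → 𝕜ˣ) {a b : ℕ} (d : ℕ)
    (hab : b + d ≤ a) (hc : IsRootVectorCandidate q (twoWord a (b + d)))
    (h : ¬ IsRootVector q (twoWord a (b + d))) : ¬ IsRootVector q (twoWord (a + d) b) := by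
  induction d generalizing b with
  | zero => exact h
  | succ d ih =>
    rw [← add_assoc, add_right_comm] at hc h
    have h1 := ih (b := b + 1) (by omega) hc h
    refine not_isRootVector_twoWord_succ (k := a + d) q (by omega) ?_ h1
    rcases Nat.eq_zero_or_pos d with rfl | hd
    · exact hc
    · exact isRootVectorCandidate_of_isLyndon q (isLyndon_twoWord (by omega))

end DiagNichols


theorem proposition4p3 {𝕜 : Type*} [Field 𝕜] (q : Fin 2 → Fin 2 → 𝕜ˣ) :
    (∀ k l : ℕ, 1 ≤ l → l ≤ k →
      DiagNichols.IsRootVectorCandidate q (DiagNichols.twoWord k l) →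
      ¬ DiagNichols.IsRootVector q (DiagNichols.twoWord k l) →
      ¬ DiagNichols.IsRootVector q (DiagNichols.twoWord (k + 1) (l - 1))) ∧
    (∀ (m : ℕ) (w w' : List (Fin 2)),
      DiagNichols.wordDeg w = ![(m : ℤ), 2] → DiagNichols.wordDeg w' = ![(m : ℤ), 2] →
      DiagNichols.IsRootVectorCandidate q w' → w < w' →
      DiagNichols.IsRootVector q w → DiagNichols.IsRootVector q w') := by
  refine ⟨fun k l hl hlk hc h => ?_, fun m w w' hw hw' hc' hlt hr => ?_⟩
  · obtain ⟨l, rfl⟩ := Nat.exists_eq_add_of_le' hl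
    exact DiagNichols.not_isRootVector_twoWord_succ q hlk hc h
  · obtain ⟨a, b, hab, hm, rfl⟩ := hr.1.eq_twoWord hw
    obtain ⟨a', b', hab', hm', rfl⟩ := hc'.eq_twoWord hw'
    rw [DiagNichols.twoWord_lt_iff (by omega)] at hlt
    obtain ⟨d, rfl⟩ := Nat.exists_eq_add_of_le hlt.le
    obtain rfl : b' = b + d := by omega
    by_contra h
    exact DiagNichols.not_isRootVector_twoWord_add q d hab' hc' h hr
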